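/- Let $\Delta\subset\mathbb{C}$ be a simply connected domain, $\psi$ analytic in $\Delta$, and $u\in\mathbb{C}\setminus\{0\}$. Put $F_1=\tfrac12\psi$ and, for $s\ge 1$, $F_{s+1}=-\tfrac12F_s'-\tfrac12\sum_{j=1}^{s-1}F_jF_{s-j}$; for $s\ge1$ let $E_s$ be an antiderivative of $F_s$ in $\Delta$. For $n\ge1$ and $v=\pm u$ let $$S_n(v,\xi)=\sum_{s=1}^{n-1}\frac{E_s(\xi)}{v^s},\qquad T_n(v,\xi)=\sum_{s=0}^{n-2}\frac{F_{s+1}(\xi)}{v^s},\qquad \chi_n(v,\xi)=2F_n(\xi)-\sum_{s=1}^{n-1}\frac{1}{v^s}\sum_{k=s}^{n-1}F_k(\xi)F_{s+n-k-1}(\xi).$$ Let $j\in\{1,2\}$. A *progressive path* from infinity to $\xi$ (for $j$) is a path in $\Delta$ ending at $\xi$ that is a finite chain of $R_2$ arcs (twice continuously differentiable, with nonvanishing derivative; the arc at infinity is parametrized by a half-line), along which $\mathrm{Re}\,((-1)^jut)$ is nonincreasing as $t$ passes from infinity to $\xi$ and tends to $+\infty$ as $t$ tends to infinity. Let $\mathcal{L}_j$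 be such a path and let $\alpha_j$ be the point at infinity on $\mathcal{L}_j$, so that $\mathrm{Re}(u\alpha_j)=(-1)^j\infty$. Let numbers $E_s(\alpha_j)$ ($s\ge1$) be given. For a progressive path $\mathcal{P}$, say that *order $n$ converges along $\mathcal{P}$* if $\int_{\mathcal P}|\chi_n(\pm u,t)\,dt|<\infty$, $\int_{\mathcal P}|T_n(\pm u,t)\,dt|<\infty$, and $E_s\to E_s(\alpha_j)$ along $\mathcal P$ towards infinity for $1\le s\le n-1$. (Here and below the upper sign is taken for $j=1$, the lower sign for $j=2$.) Assume that at least one order $n\ge1$ converges along $\mathcal{L}_j$. Then there are a function $W_j$, independent of $n$, and functions $\varepsilon_{n,j}$ ($n\ge1$) such that $W_j$ is an analytic solution in $\Delta$ of $$\frac{d^2W}{d\xi^2}=\{u^2+\psi(\xi)\}W,$$ and, for all $n\ge1$ and $\xi\in\Delta$, $$W_j(\xi)=\exp\{S_n(\pm u,\xi)-S_n(\pm u,\alpha_j)\}\{e^{\pm u\xi}+\varepsilon_{n,j}(\xi)\},\qquad S_n(\pm u,\alpha_j)=\sum_{s=1}^{n-1}\frac{E_s(\alpha_j)}{(\pm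 u)^s}.$$ $W_j$ is the unique solution analytic in $\Delta$ with $W_j(\xi)=e^{\pm u\xi}\{1+o(1)\}$ as $\xi\to\alpha_j$ along $\mathcal{L}_j$, and it is, up to a constant factor, the only solution recessive at $\alpha_j$: every solution analytic in $\Delta$ that tends to $0$ as $\xi\to\alpha_j$ along $\mathcal{L}_j$ is a constant multiple of $W_j$. Moreover, let $\xi\in\Delta$ be linked with $\alpha_j$ by a progressive path $\mathcal{P}$, that is, a progressive path that coincides with $\mathcal{L}_j$ in a neighbourhood of infinity or, more generally, along which $W_j(t)=e^{\pm ut}\{1+o(1)\}$ as $t$ tends to infinity; below, the integrals $\int_{\alpha_j}^{\xi}$ are taken along $\mathcal{P}$. Let $n\ge1$. If order $n$ converges along $\mathcal{P}$, then $$|\varepsilon_{n,j}(\xi)|,\ \left|\frac1u\varepsilon_{n,j}'(\xi)\right|\le\left|\frac{e^{\pm u\xi}}{u^n}\right|\int_{\alpha_j}^{\xi}|\chi_n(\pm u,t)dt|\,\exp\left\{\frac{4}{|u|}\int_{\alpha_j}^{\xi}|T_n(\pm u,t)dt|+\frac{1}{|u|^n}\int_{\alpha_j}^{\xi}|\chi_n(\pm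 u,t)dt|\right\}.$$ If $r$ is a positive integer and order $n+r$ converges along $\mathcal{P}$, then $$|e^{\mp u\xi}\varepsilon_{n,j}(\xi)|\le\left|e^{D}-1\right|+\frac{1}{|u|^{n+r}}\int_{\alpha_j}^{\xi}|\chi_{n+r}(\pm u,t)dt|\,\exp\left\{\frac{4}{|u|}\int_{\alpha_j}^{\xi}|T_{n+r}(\pm u,t)dt|+\frac{1}{|u|^{n+r}}\int_{\alpha_j}^{\xi}|\chi_{n+r}(\pm u,t)dt|+\mathrm{Re}\,D\right\},$$ where $$D=\sum_{s=n}^{n+r-1}(\pm1)^s\,\frac{E_s(\xi)-E_s(\alpha_j)}{u^s}.$$ -/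

import Mathlib

open Set Filter Topology MeasureTheory

noncomputable section

namespace LiouvilleGreen

/-- The coefficients `F_s`, `s ≥ 1`, attached to `ψ` : `F₁ = ψ / 2` and
`F_{s+1} = -(1/2) F_s' - (1/2) ∑_{j=1}^{s-1} F_j F_{s-j}` for `s ≥ 1`
(for `s = 1` the sum is empty, which gives `F₂ = -ψ' / 4`). The value at index `0` is not used. -/
def F (ψ : ℂ → ℂ) : ℕ → ℂ → ℂ
  | 0 => fun _ => 0
  | 1 => fun ξ => (1 / 2) * ψ ξ
  | s + 2 => fun ξ =>
      -(1 / 2) * deriv (F ψ (s + 1)) ξ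
        - (1 / 2) * ∑ j ∈ (Finset.Icc 1 s).attach, F ψ j.1 ξ * F ψ (s + 1 - j.1) ξ
  decreasing_by
    all_goals first
      | (have hj := Finset.mem_Icc.1 j.2; omega)
      | omega

/-- `∑_{s=1}^{n-1} e_s / v^s`. With `e_s = E_s(ξ)` this is `S_n(v, ξ)`, and with
`e_s = E_s(α)` it is `S_n(v, α)`. -/
def S (e : ℕ → ℂ) (n : ℕ) (v : ℂ) : ℂ :=
  ∑ s ∈ Finset.Ico 1 n, e s / v ^ s

/-- `T_n(v, ξ) = ∑_{s=0}^{n-2} F_{s+1}(ξ) / v^s`. -/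
def T (ψ : ℂ → ℂ) (n : ℕ) (v ξ : ℂ) : ℂ :=
  ∑ s ∈ Finset.range (n - 1), F ψ (s + 1) ξ / v ^ s

/-- `G_{n,s}(ξ) = ∑_{k=s}^{n-1} F_k(ξ) F_{s+n-k-1}(ξ)`, for `1 ≤ s ≤ n - 1`. -/
def G (ψ : ℂ → ℂ) (n s : ℕ) (ξ : ℂ) : ℂ :=
  ∑ k ∈ Finset.Ico s n, F ψ k ξ * F ψ (s + n - k - 1) ξ

/-- `χ_n(v, ξ) = 2 F_n(ξ) - ∑_{s=1}^{n-1} G_{n,s}(ξ) / v^s`. -/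
def chi (ψ : ℂ → ℂ) (n : ℕ) (v ξ : ℂ) : ℂ :=
  2 * F ψ n ξ - ∑ s ∈ Finset.Ico 1 n, G ψ n s ξ / v ^ s

/-- `W` is a holomorphic solution on `Δ` of `d²W/dξ² = (u² + ψ(ξ)) W`. -/
def IsSolution (Δ : Set ℂ) (ψ : ℂ → ℂ) (u : ℂ) (W : ℂ → ℂ) : Prop :=
  DifferentiableOn ℂ W Δ ∧ ∀ ξ ∈ Δ, deriv (deriv W) ξ = (u ^ 2 + ψ ξ) * W ξ

/-- `γ` restricted to the closed parameter interval `I` is an `R₂` arc: it is twice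
continuously differentiable with nonvanishing derivative (one-sided at end points). -/
def IsR2Arc (γ : ℝ → ℂ) (I : Set ℝ) : Prop :=
  ContDiffOn ℝ 2 γ I ∧ ∀ t ∈ I, derivWithin γ I t ≠ 0

/-- `γ` on `[0, ∞)` is a finite chain of `R₂` arcs, the last one of which is parametrized by
an infinite interval. -/
def IsR2Chain (γ : ℝ → ℂ) : Prop :=
  ∃ (k : ℕ) (τ : ℕ → ℝ), τ 0 = 0 ∧ (∀ i < k, τ i < τ (i + 1)) ∧
    (∀ i < k, IsR2Arc γ (Icc (τ i) (τ (i + 1)))) ∧ IsR2Arc γ (Ici (τ k))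

/-- `γ`, on `[0, ∞)`, is a progressive path in `Δ` that links its initial point `γ 0` with a
point at infinity at which `Re (v t) = -∞`. The path is traversed from `ξ = γ 0` towards
infinity, so `Re (v t)` being nonincreasing along `γ` says that `Re (v t)` is nondecreasing,
i.e. `Re (-v t)` is nonincreasing, as `t` passes from infinity to `ξ`.
For `v = u` the end is a point `α₁` with `Re (u α₁) = -∞`; for `v = -u` it is a point `α₂`
with `Re (u α₂) = +∞`. -/
structure IsProgressive (Δ : Set ℂ) (v : ℂ) (γ : ℝ → ℂ) : Prop where
  chain : IsR2Chain γ
  mem : ∀ t, 0 ≤ t → γ t ∈ Δ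
  antitone : AntitoneOn (fun t => (v * γ t).re) (Ici 0)
  infinite : Tendsto (fun t => (v * γ t).re) atTop atBot

/-- The two paths coincide in a neighbourhood of infinity. -/
def SameEnd (γ L : ℝ → ℂ) : Prop :=
  ∃ a b : ℝ, 0 ≤ a ∧ 0 ≤ b ∧ ∀ t, 0 ≤ t → γ (a + t) = L (b + t)

/-- `∫ |h(t) dt|` along the path `γ` on `[0, ∞)`. -/
def arcInt (h : ℂ → ℂ) (γ : ℝ → ℂ) : ℝ :=
  ∫ t in Ioi (0 : ℝ), ‖h (γ t)‖ * ‖deriv γ t‖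

/-- The integral `∫ |h(t) dt|` along `γ` converges. -/
def ArcConverges (h : ℂ → ℂ) (γ : ℝ → ℂ) : Prop :=
  IntegrableOn (fun t => ‖h (γ t)‖ * ‖deriv γ t‖) (Ioi 0)

/-- The quantities of order `n` at the infinite end `α` of `γ` exist: the integrals
of `|χ_n(v, t) dt|` and `|T_n(v, t) dt|` along `γ` converge, and, for `1 ≤ s ≤ n - 1`, the
number `Eα s` is the value `E_s(α)`, i.e. the limit of `E_s` along `γ`. -/
structure Converges (ψ : ℂ → ℂ) (E : ℕ → ℂ → ℂ) (n : ℕ) (v : ℂ) (γ : ℝ → ℂ)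
    (Eα : ℕ → ℂ) : Prop where
  chi_conv : ArcConverges (chi ψ n v) γ
  T_conv : ArcConverges (T ψ n v) γ
  E_lim : ∀ s ∈ Finset.Ico 1 n, Tendsto (fun t => E s (γ t)) atTop (𝓝 (Eα s))

end LiouvilleGreen

end

/-! Write `v = ±u`. The exponent of the order-`n` approximation `Y = lgApprox E Eα n v` is chosen so
that its logarithmic derivative `v + T_n / v` satisfies the Riccati equation of `W'' = (v² + ψ) W`
up to the residual `v χ_n / v ^ n` (`riccati`). With `p = T_n / v` and `q = χ_n / v ^ n`, a solution
written as `W = Y (1 + h)` satisfies `h'' + 2 (v + p) h' = v q (1 + h)`.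

Along a progressive path `|e^{2vz}|` decreases towards infinity. If `h` and `h'` vanish at a point
of the path, integration back from there and Gronwall's inequality bound `h`, `h' / v` and `h + h' /
v` by integrals of `|p|` and `|q|` (`norm_perturbation_le`). These bounds are uniform in the point,
so a subsequence of solutions matching `Y` at ever more distant points converges to a solution
asymptotic to `Y` (`IsApproxSolution.exists_recessive`). Simple connectedness makes all solutions
global (`exists_global_solution`).

Any solution tending to `0` along the path has zero Wronskian with this one
(`IsApproxSolution.wronskian_eq_zero`), hence is a multiple of it. Normalization at infinity
therefore determines the solution, so the solutions built from different orders and different paths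
coincide. Each order thus supplies its error bound for one and the same `W`. Comparing orders `n`
and `n + r` only needs `Y_{n+r} = e^D Y_n`. The case `v = -u` follows because the equation contains
only `u²`. -/

namespace LiouvilleGreen

/-! ### Local and global solvability of `W'' = q W`. -/

/-- One Picard step for `W'' = q W` on a small ball. -/
theorem exists_picard_step {q : ℂ → ℂ} {c : ℂ} {r M : ℝ} (hr1 : r ≤ 1)
    (hq : DifferentiableOn ℂ q (Metric.ball c r)) (hM : ∀ z ∈ Metric.ball c r, ‖q z‖ ≤ M)
    (hMr : M * r ≤ 1 / 2) (hr : 0 < r) {f : ℂ → ℂ}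
    (hf : DifferentiableOn ℂ f (Metric.ball c r)) :
    ∃ g g' : ℂ → ℂ, (∀ z ∈ Metric.ball c r, HasDerivAt g (g' z) z) ∧
      (∀ z ∈ Metric.ball c r, HasDerivAt g' (q z * f z) z) ∧ g c = 0 ∧ g' c = 0 ∧
      ∀ C, (∀ z ∈ Metric.ball c r, ‖f z‖ ≤ C) →
        ∀ z ∈ Metric.ball c r, ‖g z‖ ≤ C / 2 ∧ ‖g' z‖ ≤ C / 2 := by
  obtain ⟨g', hg'c, hg'⟩ := (hq.mul hf).isExactOn_ball.with_val_at c 0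
  have hg'd : DifferentiableOn ℂ g' (Metric.ball c r) :=
    fun z hz => (hg' z hz).differentiableAt.differentiableWithinAt
  obtain ⟨g, hgc, hg⟩ := hg'd.isExactOn_ball.with_val_at c 0
  have hc : c ∈ Metric.ball c r := Metric.mem_ball_self hr
  refine ⟨g, g', hg, hg', hgc, hg'c, fun C hC => ?_⟩
  have hC0 : 0 ≤ C := (norm_nonneg _).trans (hC c hc)
  have hM0 : 0 ≤ M := (norm_nonneg _).trans (hM c hc)
  have key : ∀ (k k' : ℂ → ℂ) (D : ℝ), k c = 0 → 0 ≤ D →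
      (∀ z ∈ Metric.ball c r, HasDerivAt k (k' z) z) →
      (∀ z ∈ Metric.ball c r, ‖k' z‖ ≤ D) → ∀ z ∈ Metric.ball c r, ‖k z‖ ≤ D * r := by
    intro k k' D hkc hD hk hk' z hz
    have := (convex_ball c r).norm_image_sub_le_of_norm_hasDerivWithin_le
      (fun x hx => (hk x hx).hasDerivWithinAt) hk' hc hz
    rw [hkc, sub_zero] at this
    refine this.trans ?_
    gcongr
    exact (mem_ball_iff_norm.1 hz).le
  have h1 : ∀ z ∈ Metric.ball c r, ‖g' z‖ ≤ C / 2 := by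
    intro z hz
    refine (key g' _ (M * C) hg'c (by positivity) hg' ?_ z hz).trans ?_
    · intro w hw
      rw [Pi.mul_apply, norm_mul]
      exact mul_le_mul (hM w hw) (hC w hw) (norm_nonneg _) hM0
    · calc M * C * r = (M * r) * C := by ring
        _ ≤ 1 / 2 * C := by gcongr
        _ = C / 2 := by ring
  refine fun z hz => ⟨?_, h1 z hz⟩
  refine (key g g' (C / 2) hgc (by positivity) hg h1 z hz).trans ?_
  nlinarith

/-- Local solvability of the initial value problem for `W'' = q W`. -/
theorem exists_local_solution {q : ℂ → ℂ} {Δ : Set ℂ} (hΔ : IsOpen Δ)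
    (hq : DifferentiableOn ℂ q Δ) {c : ℂ} (hc : c ∈ Δ) :
    ∃ r > 0, Metric.ball c r ⊆ Δ ∧ ∀ a b : ℂ, ∃ W W' : ℂ → ℂ,
      (∀ z ∈ Metric.ball c r, HasDerivAt W (W' z) z) ∧
      (∀ z ∈ Metric.ball c r, HasDerivAt W' (q z * W z) z) ∧ W c = a ∧ W' c = b := by
  obtain ⟨R, hR, hRΔ⟩ := Metric.isOpen_iff.1 hΔ c hc
  have hqc : ContinuousAt q c := (hq.differentiableAt (hΔ.mem_nhds hc)).continuousAt
  obtain ⟨ρ, hρ, hρq⟩ := Metric.continuousAt_iff.1 hqc 1 one_pos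
  set M : ℝ := ‖q c‖ + 1 with hMdef
  have hM0 : 0 < M := by positivity
  -- `r ≤ 1` and `M r ≤ 1/2` make each Picard step halve the sup norm. The radius does not depend on
  -- the initial data `a`, `b`.
  set r : ℝ := min (min R ρ) (min 1 (1 / (2 * M)))
  have hr : 0 < r := by positivity
  have hr1 : r ≤ 1 := (min_le_right _ _).trans (min_le_left _ _)
  have hrM : M * r ≤ 1 / 2 := by
    calc M * r ≤ M * (1 / (2 * M)) := by
          gcongr
          exact (min_le_right _ _).trans (min_le_right _ _)
      _ = 1 / 2 := by field_simp
  have hsub : Metric.ball c r ⊆ Δ :=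
    (Metric.ball_subset_ball ((min_le_left _ _).trans (min_le_left _ _))).trans hRΔ
  have hM : ∀ z ∈ Metric.ball c r, ‖q z‖ ≤ M := by
    intro z hz
    have h1 := hρq (lt_of_lt_of_le (Metric.mem_ball.1 hz)
      ((min_le_left _ _).trans (min_le_right _ _)))
    rw [dist_eq_norm] at h1
    calc ‖q z‖ = ‖q c + (q z - q c)‖ := by ring_nf
      _ ≤ ‖q c‖ + ‖q z - q c‖ := norm_add_le _ _
      _ ≤ M := by linarith
  have hcb : c ∈ Metric.ball c r := Metric.mem_ball_self hr
  refine ⟨r, hr, hsub, fun a b => ?_⟩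
  have step := fun f : {f : ℂ → ℂ // DifferentiableOn ℂ f (Metric.ball c r)} =>
    exists_picard_step hr1 (hq.mono hsub) hM hrM hr f.2
  choose g g' hg hg' hgc hg'c hgb using step
  have hgd : ∀ f, DifferentiableOn ℂ (g f) (Metric.ball c r) :=
    fun f z hz => (hg f z hz).differentiableAt.differentiableWithinAt
  have hg'd : ∀ f, DifferentiableOn ℂ (g' f) (Metric.ball c r) :=
    fun f z hz => (hg' f z hz).differentiableAt.differentiableWithinAt
  let w0 : {f : ℂ → ℂ // DifferentiableOn ℂ f (Metric.ball c r)} :=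
    ⟨fun z => a + b * (z - c), by fun_prop⟩
  let w : ℕ → {f : ℂ → ℂ // DifferentiableOn ℂ f (Metric.ball c r)} :=
    fun k => Nat.rec w0 (fun _ f => ⟨g f, hgd f⟩) k
  have hw1 : ∀ k, w (k + 1) = ⟨g (w k), hgd (w k)⟩ := fun k => rfl
  set C : ℝ := ‖a‖ + ‖b‖
  have hwb : ∀ k, ∀ z ∈ Metric.ball c r, ‖(w k).1 z‖ ≤ C * (1 / 2) ^ k := by
    intro k
    induction k with
    | zero =>
      intro z hz
      have h1 : ‖z - c‖ ≤ 1 := (mem_ball_iff_norm.1 hz).le.trans hr1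
      calc ‖a + b * (z - c)‖ ≤ ‖a‖ + ‖b * (z - c)‖ := norm_add_le _ _
        _ = ‖a‖ + ‖b‖ * ‖z - c‖ := by rw [norm_mul]
        _ ≤ ‖a‖ + ‖b‖ * 1 := by gcongr
        _ = C * (1 / 2) ^ 0 := by simp [C]
    | succ k ih =>
      intro z hz
      have := (hgb (w k) _ ih z hz).1
      rw [hw1]
      refine this.trans (le_of_eq ?_)
      rw [pow_succ]; ring
  have hw'b : ∀ k, ∀ z ∈ Metric.ball c r, ‖g' (w k) z‖ ≤ C * (1 / 2) ^ k := by
    intro k z hz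
    refine ((hgb (w k) _ (hwb k) z hz).2).trans ?_
    have : 0 ≤ C * (1 / 2) ^ k := by positivity
    linarith
  have hsum : Summable fun k : ℕ => C * (1 / 2 : ℝ) ^ k :=
    summable_geometric_two.mul_left C
  have hD : ∀ z ∈ Metric.ball c r,
      HasDerivAt (fun z => ∑' k, g (w k) z) (∑' k, g' (w k) z) z := by
    intro z hz
    have hb : ∀ k, ∀ z ∈ Metric.ball c r, ‖g (w k) z‖ ≤ C * (1 / 2) ^ k := by
      intro k z hz
      refine ((hgb (w k) _ (hwb k) z hz).1).trans ?_
      have : 0 ≤ C * (1 / 2) ^ k := by positivity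
      linarith
    have h1 := Complex.differentiableOn_tsum_of_summable_norm hsum (fun k => hgd (w k))
      Metric.isOpen_ball hb
    have h2 := Complex.hasSum_deriv_of_summable_norm hsum (fun k => hgd (w k))
      Metric.isOpen_ball hb hz
    have h3 := (h1.differentiableAt (Metric.isOpen_ball.mem_nhds hz)).hasDerivAt
    rw [← h2.tsum_eq] at h3
    simpa only [(hg _ z hz).deriv] using h3
  have hD' : ∀ z ∈ Metric.ball c r,
      HasDerivAt (fun z => ∑' k, g' (w k) z) (∑' k, q z * (w k).1 z) z := by
    intro z hz
    have h1 := Complex.differentiableOn_tsum_of_summable_norm hsum (fun k => hg'd (w k))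
      Metric.isOpen_ball hw'b
    have h2 := Complex.hasSum_deriv_of_summable_norm hsum (fun k => hg'd (w k))
      Metric.isOpen_ball hw'b hz
    have h3 := (h1.differentiableAt (Metric.isOpen_ball.mem_nhds hz)).hasDerivAt
    rw [← h2.tsum_eq] at h3
    simpa only [(hg' _ z hz).deriv] using h3
  refine ⟨fun z => (a + b * (z - c)) + ∑' k, g (w k) z, fun z => b + ∑' k, g' (w k) z,
    fun z hz => ?_, fun z hz => ?_, ?_, ?_⟩
  · have h1 : HasDerivAt (fun z : ℂ => a + b * (z - c)) b z := by
      simpa using (((hasDerivAt_id z).sub_const c).const_mul b).const_add a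
    exact h1.add (hD z hz)
  · have hs : Summable fun k => (w k).1 z :=
      Summable.of_norm_bounded hsum fun k => hwb k z hz
    -- The proposed solution is the Neumann series `∑ w k`: its zeroth term is the affine function,
    -- and `g (w k) = w (k + 1)`.
    have h1 : q z * ((a + b * (z - c)) + ∑' k, g (w k) z) = ∑' k, q z * (w k).1 z := by
      rw [tsum_mul_left, hs.tsum_eq_zero_add]
      simp only [hw1]
      rfl
    rw [h1]
    exact (hD' z hz).const_add b
  · simp [hgc]
  · simp [hg'c]

/-- The Wronskian of two solutions of `W'' = q W` on a preconnected open set is constant. -/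
theorem wronskian_eq {q A A' B B' : ℂ → ℂ} {U : Set ℂ} (hU : IsOpen U) (hUc : IsPreconnected U)
    (hA : ∀ z ∈ U, HasDerivAt A (A' z) z) (hA' : ∀ z ∈ U, HasDerivAt A' (q z * A z) z)
    (hB : ∀ z ∈ U, HasDerivAt B (B' z) z) (hB' : ∀ z ∈ U, HasDerivAt B' (q z * B z) z)
    {x y : ℂ} (hx : x ∈ U) (hy : y ∈ U) :
    A x * B' x - A' x * B x = A y * B' y - A' y * B y := by
  have h : ∀ z ∈ U, HasDerivAt (fun z => A z * B' z - A' z * B z) 0 z := fun z hz =>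
    (((hA z hz).mul (hB' z hz)).sub ((hA' z hz).mul (hB z hz))).congr_deriv (by ring)
  exact hU.is_const_of_deriv_eq_zero hUc
    (fun z hz => (h z hz).differentiableAt.differentiableWithinAt) (fun z hz => (h z hz).deriv)
    hx hy

/-- Initial data of a second order equation, as a discrete space. -/
def InitialData : Type := ℂ × ℂ

instance : TopologicalSpace InitialData := ⊥

instance : DiscreteTopology InitialData := ⟨rfl⟩

/-- On a simply connected domain, every initial value problem for `W'' = q W` has a solution. -/
theorem exists_global_solution {q : ℂ → ℂ} {Δ : Set ℂ} (hΔ : IsOpen Δ)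
    (hΔc : IsSimplyConnected Δ) (hq : DifferentiableOn ℂ q Δ) {c : ℂ} (hc : c ∈ Δ) (a b : ℂ) :
    ∃ W W' : ℂ → ℂ, (∀ z ∈ Δ, HasDerivAt W (W' z) z) ∧
      (∀ z ∈ Δ, HasDerivAt W' (q z * W z) z) ∧ W c = a ∧ W' c = b := by
  classical
  have hloc : ∀ i : Δ, ∃ r > 0, Metric.ball i.1 r ⊆ Δ ∧ ∃ A A' B B' : ℂ → ℂ,
      (∀ z ∈ Metric.ball i.1 r, HasDerivAt A (A' z) z) ∧
      (∀ z ∈ Metric.ball i.1 r, HasDerivAt A' (q z * A z) z) ∧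
      (∀ z ∈ Metric.ball i.1 r, HasDerivAt B (B' z) z) ∧
      (∀ z ∈ Metric.ball i.1 r, HasDerivAt B' (q z * B z) z) ∧
      A i = 1 ∧ A' i = 0 ∧ B i = 0 ∧ B' i = 1 := by
    intro i
    obtain ⟨r, hr, hsub, h⟩ := exists_local_solution hΔ hq i.2
    obtain ⟨A, A', h1, h2, h3, h4⟩ := h 1 0
    obtain ⟨B, B', h5, h6, h7, h8⟩ := h 0 1
    exact ⟨r, hr, hsub, A, A', B, B', h1, h2, h5, h6, h3, h4, h7, h8⟩
  choose r hr hsub A A' B B' hA hA' hB hB' hA1 hA0 hB0 hB1 using hloc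
  have hW : ∀ i, ∀ z ∈ Metric.ball i.1 (r i), A i z * B' i z - A' i z * B i z = 1 := by
    intro i z hz
    rw [wronskian_eq Metric.isOpen_ball (convex_ball _ _).isPreconnected (hA i) (hA' i) (hB i)
      (hB' i) hz (Metric.mem_ball_self (hr i)), hA1, hA0, hB0, hB1]
    ring
  -- The bundle of germs of solutions, with coordinates relative to the local basis `A i`, `B i`.
  -- Its fibre is discrete, so it is a covering, and a global solution is a section.
  let Z : FiberBundleCore Δ Δ InitialData :=
    { baseSet := fun i => {x : Δ | x.1 ∈ Metric.ball i.1 (r i)}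
      isOpen_baseSet := fun i => Metric.isOpen_ball.preimage continuous_subtype_val
      indexAt := id
      mem_baseSet_at := fun x => Metric.mem_ball_self (hr x)
      -- Cramer's rule with Wronskian 1: the coordinates relative to `A j`, `B j` of the solution
      -- `d.1 A i + d.2 B i`.
      coordChange := fun i j x d =>
        ((d.1 * A i x + d.2 * B i x) * B' j x - (d.1 * A' i x + d.2 * B' i x) * B j x,
          A j x * (d.1 * A' i x + d.2 * B' i x) - A' j x * (d.1 * A i x + d.2 * B i x))
      coordChange_self := by
        intro i x hx d
        have h := hW i x hx
        refine Prod.ext ?_ ?_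
        · show _ = d.1
          linear_combination d.1 * h
        · show _ = d.2
          linear_combination d.2 * h
      -- The new coordinates are themselves Wronskians of two solutions, hence constant on the
      -- convex overlap of the two balls.
      continuousOn_coordChange := by
        intro i j
        have hUo : IsOpen (Metric.ball i.1 (r i) ∩ Metric.ball j.1 (r j)) :=
          Metric.isOpen_ball.inter Metric.isOpen_ball
        have hUc : IsPreconnected (Metric.ball i.1 (r i) ∩ Metric.ball j.1 (r j)) :=
          ((convex_ball _ _).inter (convex_ball _ _)).isPreconnected
        rintro ⟨x, d⟩ ⟨hx, -⟩
        refine ContinuousAt.continuousWithinAt ?_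
        let d' : InitialData :=
          ((d.1 * A i x + d.2 * B i x) * B' j x - (d.1 * A' i x + d.2 * B' i x) * B j x,
            A j x * (d.1 * A' i x + d.2 * B' i x) - A' j x * (d.1 * A i x + d.2 * B i x))
        refine ContinuousAt.congr (f := fun _ => d') continuousAt_const ?_
        have h1 : ∀ᶠ p : Δ × InitialData in 𝓝 (x, d),
            p.1.1 ∈ Metric.ball i.1 (r i) ∩ Metric.ball j.1 (r j) :=
          (continuous_subtype_val.comp continuous_fst).continuousAt.eventually
            (hUo.mem_nhds hx)
        have h2 : ∀ᶠ p : Δ × InitialData in 𝓝 (x, d), p.2 = d :=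
          continuous_snd.continuousAt.eventually (p := fun e : InitialData => e = d)
            (mem_nhds_discrete.2 rfl : {d} ∈ 𝓝 d)
        filter_upwards [h1, h2] with p hp hpd
        obtain ⟨y, e⟩ := p
        obtain rfl : e = d := hpd
        have hsol : ∀ z ∈ Metric.ball i.1 (r i) ∩ Metric.ball j.1 (r j),
            HasDerivAt (fun z => e.1 * A i z + e.2 * B i z) (e.1 * A' i z + e.2 * B' i z) z :=
          fun z hz => ((hA i z hz.1).const_mul _).add ((hB i z hz.1).const_mul _)
        have hsol' : ∀ z ∈ Metric.ball i.1 (r i) ∩ Metric.ball j.1 (r j),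
            HasDerivAt (fun z => e.1 * A' i z + e.2 * B' i z)
              (q z * (e.1 * A i z + e.2 * B i z)) z :=
          fun z hz => (((hA' i z hz.1).const_mul _).add ((hB' i z hz.1).const_mul _)).congr_deriv
            (by ring)
        refine Prod.ext ?_ ?_
        · exact wronskian_eq hUo hUc hsol hsol' (fun z hz => hB j z hz.2)
            (fun z hz => hB' j z hz.2) hx hp
        · exact wronskian_eq hUo hUc (fun z hz => hA j z hz.2)
            (fun z hz => hA' j z hz.2) hsol hsol' hx hp
      coordChange_comp := by
        intro i j k x hx d
        have h := hW j x hx.1.2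
        refine Prod.ext ?_ ?_
        · linear_combination ((d.1 * A i x + d.2 * B i x) * B' k x
            - (d.1 * A' i x + d.2 * B' i x) * B k x) * h
        · linear_combination (A k x * (d.1 * A' i x + d.2 * B' i x)
            - A' k x * (d.1 * A i x + d.2 * B i x)) * h }
  have hcov : IsCoveringMap Z.proj :=
    IsFiberBundle.isCoveringMap fun x => ⟨Z.localTriv x, Metric.mem_ball_self (hr x)⟩
  have : SimplyConnectedSpace Δ := hΔc
  have : LocallyPathConnectedSpace Δ := hΔ.locallyPathConnectedSpace
  -- Lifting the identity of the simply connected `Δ` through the covering is the monodromy theorem.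
  obtain ⟨s, ⟨hsc, hsp⟩, -⟩ := hcov.existsUnique_continuousMap_lifts (ContinuousMap.id Δ)
    ⟨c, hc⟩ (⟨⟨c, hc⟩, (a, b)⟩ : Z.TotalSpace) rfl
  have hs1 : ∀ x, (s x).1 = x := fun x => congrFun hsp x
  -- Since `indexAt = id` and the basis at `x` is normalized at `x`, these coordinates are the value
  -- and the derivative of the solution at `x`.
  let D : Δ → InitialData := fun x => (s x).2
  have hDloc : ∀ x₀ : Δ, ∃ d : ℂ × ℂ, ∀ᶠ x in 𝓝 x₀,
      D x = (d.1 * A x₀ x + d.2 * B x₀ x, d.1 * A' x₀ x + d.2 * B' x₀ x) := by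
    intro x₀
    let t := Z.localTriv x₀
    have hx₀ : x₀ ∈ Z.baseSet x₀ := Metric.mem_ball_self (hr x₀)
    have hcont : ContinuousAt (fun x => (t (s x)).2) x₀ := by
      refine continuous_snd.continuousAt.comp ?_
      refine ContinuousAt.comp (t.toOpenPartialHomeomorph.continuousAt ?_) s.continuous.continuousAt
      rw [t.mem_source]
      show (s x₀).1 ∈ Z.baseSet x₀
      rw [hs1]; exact hx₀
    refine ⟨(t (s x₀)).2, ?_⟩
    have h1 : ∀ᶠ x in 𝓝 x₀, (t (s x)).2 = (t (s x₀)).2 :=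
      hcont.eventually (mem_nhds_discrete.2 rfl : {(t (s x₀)).2} ∈ 𝓝 _)
    filter_upwards [h1, (Z.isOpen_baseSet x₀).mem_nhds hx₀] with x hx hxb
    rw [← hx]
    have h2 : (t (s x)).2 = Z.coordChange x x₀ x (D x) := by
      show Z.coordChange (s x).1 x₀ (s x).1 (s x).2 = _
      rw [hs1]
    have hxx : x ∈ Z.baseSet x := Metric.mem_ball_self (hr x)
    have h3 : Z.coordChange x₀ x x (Z.coordChange x x₀ x (D x)) = D x := by
      rw [Z.coordChange_comp x x₀ x x ⟨⟨hxx, hxb⟩, hxx⟩, Z.coordChange_self x x hxx]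
    rw [h2]
    generalize Z.coordChange x x₀ x (D x) = e at h3
    rw [← h3]
    refine Prod.ext ?_ ?_
    · show (e.1 * A x₀ x + e.2 * B x₀ x) * B' x x - (e.1 * A' x₀ x + e.2 * B' x₀ x) * B x x = _
      rw [hB1, hB0]; ring
    · show A x x * (e.1 * A' x₀ x + e.2 * B' x₀ x) - A' x x * (e.1 * A x₀ x + e.2 * B x₀ x) = _
      rw [hA1, hA0]; ring
  let W : ℂ → ℂ := fun z => if hz : z ∈ Δ then (D ⟨z, hz⟩).1 else 0
  let W' : ℂ → ℂ := fun z => if hz : z ∈ Δ then (D ⟨z, hz⟩).2 else 0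
  have hWloc : ∀ (z : ℂ) (hz : z ∈ Δ), ∃ d : ℂ × ℂ,
      W =ᶠ[𝓝 z] (fun y => d.1 * A ⟨z, hz⟩ y + d.2 * B ⟨z, hz⟩ y) ∧
      W' =ᶠ[𝓝 z] (fun y => d.1 * A' ⟨z, hz⟩ y + d.2 * B' ⟨z, hz⟩ y) := by
    intro z hz
    obtain ⟨d, hd⟩ := hDloc ⟨z, hz⟩
    rw [nhds_subtype_eq_comap, eventually_comap] at hd
    refine ⟨d, ?_, ?_⟩ <;>
    · filter_upwards [hd, hΔ.mem_nhds hz] with y hy hyΔ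
      have := hy ⟨y, hyΔ⟩ rfl
      simp only [W, W', dif_pos hyΔ, this]
  refine ⟨W, W', fun z hz => ?_, fun z hz => ?_, ?_, ?_⟩
  · obtain ⟨d, h1, h2⟩ := hWloc z hz
    have hzb := Metric.mem_ball_self (x := z) (hr ⟨z, hz⟩)
    rw [h2.eq_of_nhds]
    exact (((hA ⟨z, hz⟩ z hzb).const_mul _).add ((hB ⟨z, hz⟩ z hzb).const_mul _)).congr_of_eventuallyEq
      h1
  · obtain ⟨d, h1, h2⟩ := hWloc z hz
    have hzb := Metric.mem_ball_self (x := z) (hr ⟨z, hz⟩)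
    rw [h1.eq_of_nhds]
    exact ((((hA' ⟨z, hz⟩ z hzb).const_mul _).add
      ((hB' ⟨z, hz⟩ z hzb).const_mul _)).congr_deriv (by ring)).congr_of_eventuallyEq h2
  · simp only [W, dif_pos hc, D]
    exact congrArg (fun p : Z.TotalSpace => (p.2 : InitialData).1) hsc
  · simp only [W', dif_pos hc, D]
    exact congrArg (fun p : Z.TotalSpace => (p.2 : InitialData).2) hsc

/-! ### Chains of arcs as piecewise `C¹` paths. -/

/-- A path on `[0, ∞)` that is continuous, continuously differentiable off a countable set of
parameters, with locally integrable derivative. -/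
structure IsPiecewiseC1 (γ : ℝ → ℂ) (s : Set ℝ) : Prop where
  countable : s.Countable
  continuousOn : ContinuousOn γ (Ici 0)
  hasDerivAt : ∀ t, 0 < t → t ∉ s → HasDerivAt γ (deriv γ t) t
  continuousAt_deriv : ∀ t, 0 < t → t ∉ s → ContinuousAt (deriv γ) t
  intervalIntegrable : ∀ a b, 0 ≤ a → 0 ≤ b → IntervalIntegrable (deriv γ) volume a b

theorem IsR2Arc.hasDerivAt_of_mem_interior {γ : ℝ → ℂ} {I : Set ℝ} (h : IsR2Arc γ I) {t : ℝ}
    (ht : t ∈ interior I) : HasDerivAt γ (deriv γ t) t ∧ ContinuousAt (deriv γ) t := by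
  have hmem := isOpen_interior.mem_nhds ht
  have hc : ContDiffOn ℝ 2 γ (interior I) := h.1.mono interior_subset
  exact ⟨((hc.differentiableOn (by norm_num)).differentiableAt hmem).hasDerivAt,
    (hc.continuousOn_deriv_of_isOpen isOpen_interior (by norm_num)).continuousAt hmem⟩

/-- At a corner `deriv γ` need not be the one-sided derivative. The latter is continuous on the
closed arc and agrees with `deriv γ` off the end points. -/
theorem IsR2Arc.intervalIntegrable {γ : ℝ → ℂ} {a b : ℝ} (hab : a < b)
    (h : IsR2Arc γ (Icc a b)) : IntervalIntegrable (deriv γ) volume a b := by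
  have h1 : ContinuousOn (derivWithin γ (Icc a b)) (uIcc a b) := by
    rw [uIcc_of_le hab.le]
    exact h.1.continuousOn_derivWithin (uniqueDiffOn_Icc hab) (by norm_num)
  refine h1.intervalIntegrable.congr_ae ?_
  rw [uIoc_of_le hab.le]
  refine (ae_restrict_iff' measurableSet_Ioc).2 ?_
  have h2 : ∀ᵐ t : ℝ, t ≠ b := by simp [ae_iff, measure_singleton]
  filter_upwards [h2] with t htb ht
  exact derivWithin_of_mem_nhds (Icc_mem_nhds ht.1 (lt_of_le_of_ne ht.2 htb))

theorem IsR2Chain.isPiecewiseC1 {γ : ℝ → ℂ} (h : IsR2Chain γ) : ∃ s, IsPiecewiseC1 γ s := by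
  obtain ⟨k, τ, hτ0, hτ, harc, hlast⟩ := h
  have hcover : ∀ m ≤ k, 0 ≤ τ m ∧ (∀ t, 0 < t → t ∉ range τ → t < τ m →
      HasDerivAt γ (deriv γ t) t ∧ ContinuousAt (deriv γ) t) ∧
      ContinuousOn γ (Icc 0 (τ m)) ∧ IntervalIntegrable (deriv γ) volume 0 (τ m) := by
    intro m
    induction m with
    | zero =>
      intro _
      rw [hτ0]
      refine ⟨le_rfl, fun t h1 _ h2 => absurd h1 h2.not_gt, ?_, by simp⟩
      rw [Icc_self]; exact continuousOn_singleton _ _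
    | succ m ih =>
      intro hm
      obtain ⟨h0, h1, h2, h3⟩ := ih (by omega)
      have hlt := hτ m (by omega)
      have hA := harc m (by omega)
      refine ⟨h0.trans hlt.le, ?_, ?_, h3.trans (hA.intervalIntegrable hlt)⟩
      · intro t ht hts htm
        rcases lt_trichotomy t (τ m) with h | h | h
        · exact h1 t ht hts h
        · exact absurd ⟨m, h.symm⟩ hts
        · exact hA.hasDerivAt_of_mem_interior (by rw [interior_Icc]; exact ⟨h, htm⟩)
      · rw [← Icc_union_Icc_eq_Icc h0 hlt.le]
        exact h2.union_of_isClosed hA.1.continuousOn isClosed_Icc isClosed_Icc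
  obtain ⟨h0, h1, h2, h3⟩ := hcover k le_rfl
  have hder : ∀ t, 0 < t → t ∉ range τ →
      HasDerivAt γ (deriv γ t) t ∧ ContinuousAt (deriv γ) t := by
    intro t ht hts
    rcases lt_trichotomy t (τ k) with h | h | h
    · exact h1 t ht hts h
    · exact absurd ⟨k, h.symm⟩ hts
    · exact hlast.hasDerivAt_of_mem_interior (by rw [interior_Ici]; exact h)
  have hint : ∀ b, 0 ≤ b → IntervalIntegrable (deriv γ) volume 0 b := by
    intro b hb
    have hlt : τ k < max b (τ k) + 1 := by linarith [le_max_right b (τ k)]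
    have hA : IsR2Arc γ (Icc (τ k) (max b (τ k) + 1)) := by
      refine ⟨hlast.1.mono Icc_subset_Ici_self, fun t ht => ?_⟩
      have hu := uniqueDiffOn_Icc hlt t ht
      rw [derivWithin_subset Icc_subset_Ici_self hu
        (hlast.1.differentiableOn (by norm_num) t ht.1)]
      exact hlast.2 t ht.1
    refine (h3.trans (hA.intervalIntegrable hlt)).mono_set ?_
    rw [uIcc_of_le hb, uIcc_of_le (h0.trans hlt.le)]
    exact Icc_subset_Icc le_rfl (by linarith [le_max_left b (τ k)])
  -- The values of `τ` beyond index `k` are arbitrary, which is harmless: only countability of the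
  -- exceptional set matters.
  refine ⟨range τ, countable_range τ, ?_, fun t h h' => (hder t h h').1,
    fun t h h' => (hder t h h').2, fun a b ha hb => (hint a ha).symm.trans (hint b hb)⟩
  rw [← Icc_union_Ici_eq_Ici h0]
  exact h2.union_of_isClosed hlast.1.continuousOn isClosed_Icc isClosed_Ici

/-! ### Gronwall's inequality and the fundamental theorem of calculus along a path. -/

theorem integral_mono_off_countable {f g : ℝ → ℝ} {s : Set ℝ} (hs : s.Countable) {a b : ℝ}
    (hab : a ≤ b) (hf : IntervalIntegrable f volume a b) (hg : IntervalIntegrable g volume a b)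
    (h : ∀ t ∈ Ioo a b \ s, f t ≤ g t) : ∫ t in a..b, f t ≤ ∫ t in a..b, g t := by
  refine intervalIntegral.integral_mono_ae_restrict hab hf hg ?_
  rw [EventuallyLE, Measure.restrict_congr_set Ioo_ae_eq_Icc.symm]
  refine (ae_restrict_iff' measurableSet_Ioo).2 ?_
  filter_upwards [hs.ae_notMem volume] with t hts ht using h t ⟨ht, hts⟩

/-- Backward Gronwall inequality for `z ≤ A ∫_t^N z + B`. -/
theorem gronwall_backward {z A B : ℝ → ℝ} {s : Set ℝ} (hs : s.Countable) {a N : ℝ} (haN : a ≤ N)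
    (hz : IntervalIntegrable z volume a N) (hA : IntervalIntegrable A volume a N)
    (hB : IntervalIntegrable B volume a N)
    (hzc : ∀ t ∈ Ioo a N \ s, ContinuousAt z t) (hAc : ∀ t ∈ Ioo a N \ s, ContinuousAt A t)
    (hA0 : ∀ t, 0 ≤ A t) (hB0 : ∀ t, 0 ≤ B t)
    (h : ∀ t ∈ Ioo a N \ s, z t ≤ A t * (∫ x in t..N, z x) + B t) :
    ∫ x in a..N, z x ≤ (∫ x in a..N, B x) * Real.exp (∫ x in a..N, A x) := by
  set Z : ℝ → ℝ := fun t => ∫ x in t..N, z x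
  set α : ℝ → ℝ := fun t => ∫ x in a..t, A x
  have hsubI : ∀ {t}, t ∈ Icc a N → uIcc a t ⊆ uIcc a N := fun ht => by
    rw [uIcc_of_le ht.1, uIcc_of_le haN]; exact Icc_subset_Icc le_rfl ht.2
  have hsubI' : ∀ {t}, t ∈ Icc a N → uIcc t N ⊆ uIcc a N := fun ht => by
    rw [uIcc_of_le ht.2, uIcc_of_le haN]; exact Icc_subset_Icc ht.1 le_rfl
  have hmeas : ∀ {f : ℝ → ℝ}, IntervalIntegrable f volume a N → ∀ t ∈ Ioo a N,
      StronglyMeasurableAtFilter f (𝓝 t) := by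
    intro f hf t ht
    rw [intervalIntegrable_iff_integrableOn_Ioc_of_le haN] at hf
    exact ⟨Ioc a N, Ioc_mem_nhds ht.1 ht.2, hf.aestronglyMeasurable⟩
  have hαd : ∀ t ∈ Ioo a N \ s, HasDerivAt α (A t) t := fun t ht =>
    intervalIntegral.integral_hasDerivAt_right (hA.mono_set (hsubI ⟨ht.1.1.le, ht.1.2.le⟩))
      (hmeas hA t ht.1) (hAc t ht)
  have hZd : ∀ t ∈ Ioo a N \ s, HasDerivAt Z (-z t) t := fun t ht =>
    intervalIntegral.integral_hasDerivAt_left (hz.mono_set (hsubI' ⟨ht.1.1.le, ht.1.2.le⟩))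
      (hmeas hz t ht.1) (hzc t ht)
  have hαc : ContinuousOn α (Icc a N) := by
    have := intervalIntegral.continuousOn_primitive_interval' hA left_mem_uIcc
    rwa [uIcc_of_le haN] at this
  have hZc : ContinuousOn Z (Icc a N) := by
    have := intervalIntegral.continuousOn_primitive_interval' hz.symm left_mem_uIcc
    rw [uIcc_of_ge haN] at this
    refine this.neg.congr fun t _ => ?_
    exact intervalIntegral.integral_symm _ _
  have hαmono : ∀ t ∈ Icc a N, α t ≤ α N := by
    intro t ht
    exact intervalIntegral.integral_mono_interval le_rfl ht.1 ht.2
      (Eventually.of_forall hA0) hA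
  have hec : ContinuousOn (fun t => Real.exp (α t)) (uIcc a N) := by
    rw [uIcc_of_le haN]; exact hαc.rexp
  have hZc' : ContinuousOn (fun t => Z t * Real.exp (α t)) (uIcc a N) := by
    rw [uIcc_of_le haN]; exact hZc.mul hαc.rexp
  have hDi : IntervalIntegrable (fun t => -z t * Real.exp (α t) + A t * (Z t * Real.exp (α t)))
      volume a N := (hz.neg.mul_continuousOn hec).add (hA.mul_continuousOn hZc')
  -- The integrating factor: `(Z e^α)' = (-z + A Z) e^α ≥ -B e^α ≥ -B e^{α(N)}` off `s`, while `Z N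
  -- = 0` and `α a = 0`.
  have hint := MeasureTheory.integral_eq_of_hasDerivAt_off_countable_of_le
    (fun t => Z t * Real.exp (α t))
    (fun t => -z t * Real.exp (α t) + A t * (Z t * Real.exp (α t))) haN hs (hZc.mul hαc.rexp)
    (fun t ht => ((hZd t ht).mul (hαd t ht).exp).congr_deriv (by ring)) hDi
  have hZN : Z N = 0 := intervalIntegral.integral_same
  have hαa : α a = 0 := intervalIntegral.integral_same
  have hle : ∫ t in a..N, -(B t * Real.exp (α N)) ≤
      ∫ t in a..N, (-z t * Real.exp (α t) + A t * (Z t * Real.exp (α t))) := by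
    refine integral_mono_off_countable hs haN (hB.mul_const _).neg hDi fun t ht => ?_
    have h1 := h t ht
    have h2 : Real.exp (α t) ≤ Real.exp (α N) :=
      Real.exp_le_exp.2 (hαmono t ⟨ht.1.1.le, ht.1.2.le⟩)
    have h3 := (Real.exp_pos (α t)).le
    have h4 := mul_le_mul_of_nonneg_right h1 h3
    have h5 := mul_le_mul_of_nonneg_left h2 (hB0 t)
    simp only [Z] at *
    nlinarith
  rw [hint, intervalIntegral.integral_neg, intervalIntegral.integral_mul_const, hZN, hαa,
    Real.exp_zero] at hle
  show Z a ≤ _ * Real.exp (α N)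
  linarith

namespace IsPiecewiseC1

variable {γ : ℝ → ℂ} {s : Set ℝ} {Δ : Set ℂ}

theorem continuousOn_comp (hγ : IsPiecewiseC1 γ s) (hmem : ∀ t, 0 ≤ t → γ t ∈ Δ) {g : ℂ → ℂ}
    (hg : ContinuousOn g Δ) : ContinuousOn (fun t => g (γ t)) (Ici 0) :=
  hg.comp hγ.continuousOn fun t ht => hmem t ht

theorem intervalIntegrable_mul (hγ : IsPiecewiseC1 γ s) (hmem : ∀ t, 0 ≤ t → γ t ∈ Δ)
    {g : ℂ → ℂ} (hg : ContinuousOn g Δ) {a b : ℝ} (ha : 0 ≤ a) (hb : 0 ≤ b) :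
    IntervalIntegrable (fun t => g (γ t) * deriv γ t) volume a b :=
  (hγ.intervalIntegrable a b ha hb).continuousOn_mul
    ((hγ.continuousOn_comp hmem hg).mono fun _ ht => (le_min ha hb).trans ht.1)

theorem intervalIntegrable_norm_mul (hγ : IsPiecewiseC1 γ s) (hmem : ∀ t, 0 ≤ t → γ t ∈ Δ)
    {g : ℂ → ℂ} (hg : ContinuousOn g Δ) {a b : ℝ} (ha : 0 ≤ a) (hb : 0 ≤ b) :
    IntervalIntegrable (fun t => ‖g (γ t)‖ * ‖deriv γ t‖) volume a b := by
  simpa only [norm_mul] using (hγ.intervalIntegrable_mul hmem hg ha hb).norm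

theorem continuousAt_norm_mul (hγ : IsPiecewiseC1 γ s) (hmem : ∀ t, 0 ≤ t → γ t ∈ Δ)
    {g : ℂ → ℂ} (hg : ContinuousOn g Δ) {t : ℝ} (ht : 0 < t) (hts : t ∉ s) :
    ContinuousAt (fun t => ‖g (γ t)‖ * ‖deriv γ t‖) t :=
  (((hγ.continuousOn_comp hmem hg).continuousAt (Ici_mem_nhds ht)).norm).mul
    (hγ.continuousAt_deriv t ht hts).norm

/-- The fundamental theorem of calculus along a piecewise `C¹` path. -/
theorem integral_deriv_mul (hγ : IsPiecewiseC1 γ s) (hmem : ∀ t, 0 ≤ t → γ t ∈ Δ)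
    {f f' : ℂ → ℂ} (hf : ∀ z ∈ Δ, HasDerivAt f (f' z) z) (hf' : ContinuousOn f' Δ) {a b : ℝ}
    (ha : 0 ≤ a) (hab : a ≤ b) : ∫ t in a..b, f' (γ t) * deriv γ t = f (γ b) - f (γ a) := by
  have hfc : ContinuousOn f Δ := fun z hz => (hf z hz).continuousAt.continuousWithinAt
  refine MeasureTheory.integral_eq_of_hasDerivAt_off_countable_of_le (fun t => f (γ t)) _ hab
    hγ.countable ((hγ.continuousOn_comp hmem hfc).mono fun t ht => ha.trans ht.1)
    (fun t ht => ?_) (hγ.intervalIntegrable_mul hmem hf' ha (ha.trans hab))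
  have ht0 : 0 < t := ha.trans_lt ht.1.1
  have h := (hf (γ t) (hmem t ht0.le)).scomp t (hγ.hasDerivAt t ht0 ht.2)
  rw [smul_eq_mul, mul_comm] at h
  exact h

theorem norm_sub_le (hγ : IsPiecewiseC1 γ s) (hmem : ∀ t, 0 ≤ t → γ t ∈ Δ)
    {f f' : ℂ → ℂ} (hf : ∀ z ∈ Δ, HasDerivAt f (f' z) z) (hf' : ContinuousOn f' Δ) {a b : ℝ}
    (ha : 0 ≤ a) (hab : a ≤ b) :
    ‖f (γ b) - f (γ a)‖ ≤ ∫ t in a..b, ‖f' (γ t)‖ * ‖deriv γ t‖ := by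
  rw [← hγ.integral_deriv_mul hmem hf hf' ha hab]
  simpa only [norm_mul] using intervalIntegral.norm_integral_le_integral_norm
    (f := fun t => f' (γ t) * deriv γ t) hab

end IsPiecewiseC1

/-! ### The a priori bound for the perturbation. -/

theorem norm_exp_two_mul_le {γ : ℝ → ℂ} {v : ℂ}
    (hmono : AntitoneOn (fun t => (v * γ t).re) (Ici 0)) {a b : ℝ} (ha : 0 ≤ a) (hab : a ≤ b) :
    ‖Complex.exp (2 * v * γ b)‖ ≤ ‖Complex.exp (2 * v * γ a)‖ := by
  rw [Complex.norm_exp, Complex.norm_exp, Real.exp_le_exp]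
  have := hmono ha (ha.trans hab) hab
  have h2 : ∀ z : ℂ, (2 * v * z).re = 2 * (v * z).re := fun z => by
    rw [mul_assoc]; simp
  rw [h2, h2]; simpa using this

/-- A priori bound, along a progressive path, for the solution of
`h'' + 2 (v + p) h' = v q (1 + h)` that vanishes together with `h'` at a point of the path. -/
theorem norm_perturbation_le {Δ : Set ℂ} {γ : ℝ → ℂ} {s : Set ℝ}
    (hγ : IsPiecewiseC1 γ s) (hmem : ∀ t, 0 ≤ t → γ t ∈ Δ) {v : ℂ} (hv : v ≠ 0)
    (hmono : AntitoneOn (fun t => (v * γ t).re) (Ici 0)) {p q h h' : ℂ → ℂ}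
    (hp : ContinuousOn p Δ) (hq : ContinuousOn q Δ)
    (hh : ∀ z ∈ Δ, HasDerivAt h (h' z) z)
    (hh' : ∀ z ∈ Δ, HasDerivAt h' (v * q z * (1 + h z) - 2 * (v + p z) * h' z) z)
    {a N : ℝ} (ha : 0 ≤ a) (haN : a ≤ N) (hN : h (γ N) = 0) (hN' : h' (γ N) = 0) :
    let K := (∫ t in a..N, ‖q (γ t)‖ * ‖deriv γ t‖) *
      Real.exp (∫ t in a..N, (2 * (‖p (γ t)‖ * ‖deriv γ t‖) + ‖q (γ t)‖ * ‖deriv γ t‖))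
    ‖h (γ a)‖ ≤ K ∧ ‖h' (γ a) / v‖ ≤ K ∧ ‖h (γ a) + h' (γ a) / v‖ ≤ K := by
  intro K
  have hv' : 0 < ‖v‖ := norm_pos_iff.2 hv
  -- The equation splits into two first-order ones: `(h + h'/(2v))' = R/2` and `(e^{2vz} h'/(2v))' =
  -- e^{2vz} R/2`.
  set R : ℂ → ℂ := fun z => (v * q z * (1 + h z) - 2 * p z * h' z) / v
  have hhc : ContinuousOn h Δ := fun z hz => (hh z hz).continuousAt.continuousWithinAt
  have hhc' : ContinuousOn h' Δ := fun z hz => (hh' z hz).continuousAt.continuousWithinAt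
  have hR : ContinuousOn R Δ := by fun_prop
  set z : ℝ → ℝ := fun t => ‖R (γ t)‖ * ‖deriv γ t‖
  set A : ℝ → ℝ := fun t => 2 * (‖p (γ t)‖ * ‖deriv γ t‖) + ‖q (γ t)‖ * ‖deriv γ t‖
  set B : ℝ → ℝ := fun t => ‖q (γ t)‖ * ‖deriv γ t‖
  have hzi : ∀ {a b : ℝ}, 0 ≤ a → 0 ≤ b → IntervalIntegrable z volume a b :=
    fun h1 h2 => hγ.intervalIntegrable_norm_mul hmem hR h1 h2
  -- the two halves of `h` and `h' / v`
  have hα : ∀ t, 0 ≤ t → t ≤ N → ‖h (γ t) + h' (γ t) / (2 * v)‖ ≤ (∫ x in t..N, z x) / 2 := by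
    intro t ht htN
    have h1 : ∀ y ∈ Δ, HasDerivAt (fun y => h y + h' y / (2 * v)) (R y / 2) y := fun y hy =>
      ((hh y hy).add ((hh' y hy).div_const (2 * v))).congr_deriv (by
        simp only [R]; field_simp; ring)
    have h2 := hγ.norm_sub_le hmem h1 (hR.div_const 2) ht htN
    rw [hN, hN', zero_div, zero_add, zero_sub, norm_neg] at h2
    refine h2.trans (le_of_eq ?_)
    rw [← intervalIntegral.integral_div]
    refine intervalIntegral.integral_congr fun x _ => ?_
    simp only [z, norm_div, Complex.norm_ofNat]; ring
  have hβ : ∀ t, 0 ≤ t → t ≤ N → ‖h' (γ t) / (2 * v)‖ ≤ (∫ x in t..N, z x) / 2 := by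
    intro t ht htN
    have h0 : ∀ y, HasDerivAt (fun y => Complex.exp (2 * v * y))
        (Complex.exp (2 * v * y) * (2 * v)) y := fun y => by
      simpa using ((hasDerivAt_id y).const_mul (2 * v)).cexp
    have h1 : ∀ y ∈ Δ, HasDerivAt (fun y => Complex.exp (2 * v * y) * (h' y / (2 * v)))
        (Complex.exp (2 * v * y) * (R y / 2)) y := fun y hy =>
      ((h0 y).mul ((hh' y hy).div_const (2 * v))).congr_deriv (by
        simp only [R]; field_simp; ring)
    have hc : ContinuousOn (fun y => Complex.exp (2 * v * y) * (R y / 2)) Δ := by fun_prop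
    have h2 := hγ.norm_sub_le hmem h1 hc ht htN
    rw [hN', zero_div, mul_zero, zero_sub, norm_neg, norm_mul] at h2
    -- Monotonicity of `Re (v γ)` enters here: the exponential factor is largest at the lower limit
    -- `t` and then cancels.
    have h3 : ∫ x in t..N, ‖Complex.exp (2 * v * γ x) * (R (γ x) / 2)‖ * ‖deriv γ x‖ ≤
        ∫ x in t..N, ‖Complex.exp (2 * v * γ t)‖ * (z x / 2) := by
      refine intervalIntegral.integral_mono_on htN
        (hγ.intervalIntegrable_norm_mul hmem hc ht (ht.trans htN))
        (((hzi ht (ht.trans htN)).div_const 2).const_mul _) fun x hx => ?_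
      have h4 := norm_exp_two_mul_le hmono ht hx.1
      have h5 : 0 ≤ z x / 2 := by positivity
      refine le_trans (le_of_eq ?_) (mul_le_mul_of_nonneg_right h4 h5)
      simp only [z, norm_mul, norm_div, Complex.norm_ofNat]; ring
    rw [intervalIntegral.integral_const_mul, intervalIntegral.integral_div] at h3
    exact le_of_mul_le_mul_left (h2.trans h3) (norm_pos_iff.2 (Complex.exp_ne_zero _))
  -- All three quantities are sums or differences of the two halves. The third one controls the
  -- derivative, as `(e^{vz} h)' / v = e^{vz} (h + h'/v)`.
  have hsplit : ∀ t, 0 ≤ t → t ≤ N → ‖h (γ t)‖ ≤ (∫ x in t..N, z x) ∧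
      ‖h' (γ t) / v‖ ≤ (∫ x in t..N, z x) ∧ ‖h (γ t) + h' (γ t) / v‖ ≤ (∫ x in t..N, z x) := by
    intro t ht htN
    have h1 := hα t ht htN
    have h2 := hβ t ht htN
    set x := h (γ t) + h' (γ t) / (2 * v)
    set y := h' (γ t) / (2 * v)
    have e1 : h (γ t) = x - y := by simp only [x, y]; ring
    have e2 : h' (γ t) / v = y + y := by simp only [y]; field_simp; ring
    have e3 : h (γ t) + h' (γ t) / v = x + y := by rw [e1, e2]; ring
    refine ⟨?_, ?_, ?_⟩
    · rw [e1]; linarith [norm_sub_le x y]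
    · rw [e2]; linarith [norm_add_le y y]
    · rw [e3]; linarith [norm_add_le x y]
  have hpos : ∀ t ∈ Ioo a N \ s, 0 < t := fun t ht => ha.trans_lt ht.1.1
  have hN0 : 0 ≤ N := ha.trans haN
  have hpi := hγ.intervalIntegrable_norm_mul hmem hp ha hN0
  have hqi := hγ.intervalIntegrable_norm_mul hmem hq ha hN0
  have key : ∫ x in a..N, z x ≤ K := by
    refine gronwall_backward hγ.countable haN (hzi ha hN0) ((hpi.const_mul 2).add hqi) hqi
      (fun t ht => hγ.continuousAt_norm_mul hmem hR (hpos t ht) ht.2)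
      (fun t ht => ((hγ.continuousAt_norm_mul hmem hp (hpos t ht) ht.2).const_mul 2).add
        (hγ.continuousAt_norm_mul hmem hq (hpos t ht) ht.2))
      (fun t => by positivity) (fun t => by positivity) fun t ht => ?_
    obtain ⟨h1, h2, -⟩ := hsplit t (hpos t ht).le ht.1.2.le
    have h3 : ‖R (γ t)‖ ≤ (2 * ‖p (γ t)‖ + ‖q (γ t)‖) * (∫ x in t..N, z x) + ‖q (γ t)‖ := by
      have e : R (γ t) = q (γ t) + q (γ t) * h (γ t) - 2 * p (γ t) * (h' (γ t) / v) := by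
        simp only [R]; field_simp
      rw [e]
      calc _ ≤ ‖q (γ t)‖ + ‖q (γ t) * h (γ t)‖ + ‖2 * p (γ t) * (h' (γ t) / v)‖ :=
            (norm_sub_le _ _).trans (by gcongr; exact norm_add_le _ _)
        _ = ‖q (γ t)‖ + ‖q (γ t)‖ * ‖h (γ t)‖ + 2 * ‖p (γ t)‖ * ‖h' (γ t) / v‖ := by
            simp only [norm_mul, Complex.norm_ofNat]
        _ ≤ ‖q (γ t)‖ + ‖q (γ t)‖ * (∫ x in t..N, z x)
              + 2 * ‖p (γ t)‖ * (∫ x in t..N, z x) := by gcongr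
        _ = _ := by ring
    calc z t ≤ ((2 * ‖p (γ t)‖ + ‖q (γ t)‖) * (∫ x in t..N, z x) + ‖q (γ t)‖) * ‖deriv γ t‖ := by
          simp only [z]; gcongr
      _ = _ := by ring
  obtain ⟨h1, h2, h3⟩ := hsplit a ha haN
  exact ⟨h1.trans key, h2.trans key, h3.trans key⟩

/-! ### Algebra of the coefficients and the Riccati identity. -/

theorem two_mul_F_succ (ψ : ℂ → ℂ) {n : ℕ} (hn : 1 ≤ n) (ξ : ℂ) :
    2 * F ψ (n + 1) ξ = -deriv (F ψ n) ξ - G ψ n 1 ξ := by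
  obtain ⟨m, rfl⟩ : ∃ m, n = m + 1 := ⟨n - 1, by omega⟩
  rw [F]
  beta_reduce
  rw [Finset.sum_attach (Finset.Icc 1 m) (fun j => F ψ j ξ * F ψ (m + 1 - j) ξ), G]
  have h : Finset.Ico 1 (m + 1) = Finset.Icc 1 m := rfl
  rw [h]
  have h2 : ∑ k ∈ Finset.Icc 1 m, F ψ k ξ * F ψ (1 + (m + 1) - k - 1) ξ =
      ∑ j ∈ Finset.Icc 1 m, F ψ j ξ * F ψ (m + 1 - j) ξ :=
    Finset.sum_congr rfl fun k hk => by
      rw [show 1 + (m + 1) - k - 1 = m + 1 - k by have := Finset.mem_Icc.1 hk; omega]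
  rw [h2]; ring

/-- The extreme terms `k = s` and `k = n` both equal `F_s F_n`; the terms between them form
`G_{n,s+1}`. -/
theorem G_succ (ψ : ℂ → ℂ) {n s : ℕ} (hs : s < n) (ξ : ℂ) :
    G ψ (n + 1) s ξ = G ψ n (s + 1) ξ + 2 * F ψ s ξ * F ψ n ξ := by
  unfold G
  rw [Finset.sum_Ico_succ_top hs.le, Finset.sum_eq_sum_Ico_succ_bot hs]
  have h : ∑ k ∈ Finset.Ico (s + 1) n, F ψ k ξ * F ψ (s + (n + 1) - k - 1) ξ =
      ∑ k ∈ Finset.Ico (s + 1) n, F ψ k ξ * F ψ (s + 1 + n - k - 1) ξ :=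
    Finset.sum_congr rfl fun k _ => by rw [show s + (n + 1) = s + 1 + n by ring]
  rw [h, show s + (n + 1) - s - 1 = n by omega, show s + (n + 1) - n - 1 = s by omega]
  ring

theorem S_one (e : ℕ → ℂ) (v : ℂ) : S e 1 v = 0 := by simp [S]

theorem S_succ (e : ℕ → ℂ) {n : ℕ} (hn : 1 ≤ n) (v : ℂ) :
    S e (n + 1) v = S e n v + e n / v ^ n := by
  rw [S, Finset.sum_Ico_succ_top hn, S]

/-- An index shift showing that `T_n / v` is the derivative in `ξ` of the exponent `S_n`. -/
theorem T_div (ψ : ℂ → ℂ) {n : ℕ} (v ξ : ℂ) :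
    T ψ n v ξ / v = S (fun s => F ψ s ξ) n v := by
  rw [T, S, Finset.sum_div, Finset.sum_Ico_eq_sum_range]
  refine Finset.sum_congr rfl fun s _ => ?_
  rw [add_comm 1 s, pow_succ, div_div]

/-- Divided by `v ^ n`, this is the change of the Riccati residual when `F_n / v ^ n` is added to
the sum; it is the induction step of `riccati`. -/
theorem chi_succ (ψ : ℂ → ℂ) {n : ℕ} (hn : 1 ≤ n) {v : ℂ} (hv : v ≠ 0) (ξ : ℂ) :
    chi ψ (n + 1) v ξ = v * chi ψ n v ξ - 2 * v * F ψ n ξ - deriv (F ψ n) ξ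
      - 2 * F ψ n ξ * S (fun s => F ψ s ξ) n v - F ψ n ξ ^ 2 / v ^ n := by
  have h1 : ∑ s ∈ Finset.Ico 1 (n + 1), G ψ (n + 1) s ξ / v ^ s =
      ∑ s ∈ Finset.Ico 1 n, G ψ n (s + 1) ξ / v ^ s
        + 2 * F ψ n ξ * S (fun s => F ψ s ξ) n v + F ψ n ξ ^ 2 / v ^ n := by
    rw [Finset.sum_Ico_succ_top hn, S, Finset.mul_sum, ← Finset.sum_add_distrib]
    congr 1
    · refine Finset.sum_congr rfl fun s hs => ?_
      rw [G_succ ψ (Finset.mem_Ico.1 hs).2]; ring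
    · rw [G, Finset.sum_Ico_succ_top le_rfl, Finset.Ico_self, Finset.sum_empty,
        show n + (n + 1) - n - 1 = n by omega]
      ring
  have h2 : v * ∑ s ∈ Finset.Ico 1 n, G ψ n s ξ / v ^ s =
      G ψ n 1 ξ + ∑ s ∈ Finset.Ico 1 n, G ψ n (s + 1) ξ / v ^ s := by
    have h3 : v * ∑ s ∈ Finset.Ico 1 n, G ψ n s ξ / v ^ s =
        ∑ s ∈ Finset.Ico 0 (n - 1), G ψ n (s + 1) ξ / v ^ s := by
      rw [Finset.mul_sum, Finset.sum_Ico_eq_sum_range, Finset.range_eq_Ico]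
      refine Finset.sum_congr rfl fun s _ => ?_
      rw [add_comm 1 s, pow_succ]
      field_simp
    -- The additional term `s = n - 1` contains `G_{n,n}`, an empty sum.
    have h4 : ∑ s ∈ Finset.Ico 0 n, G ψ n (s + 1) ξ / v ^ s =
        ∑ s ∈ Finset.Ico 0 (n - 1), G ψ n (s + 1) ξ / v ^ s := by
      obtain ⟨m, rfl⟩ : ∃ m, n = m + 1 := ⟨n - 1, by omega⟩
      rw [Finset.sum_Ico_succ_top (Nat.zero_le m)]
      simp [G]
    rw [h3, ← h4, Finset.sum_eq_sum_Ico_succ_bot (by omega)]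
    simp
  rw [chi, chi, two_mul_F_succ ψ hn, h1, mul_sub, h2]
  ring

/-- The truncated Liouville–Green sum solves the Riccati equation up to `χ_n / v ^ (n - 1)`. -/
theorem riccati (ψ : ℂ → ℂ) {n : ℕ} (hn : 1 ≤ n) {v : ℂ} (hv : v ≠ 0) (ξ : ℂ) :
    S (fun s => deriv (F ψ s) ξ) n v + 2 * v * S (fun s => F ψ s ξ) n v
      + S (fun s => F ψ s ξ) n v ^ 2 = ψ ξ - v * (chi ψ n v ξ / v ^ n) := by
  induction n, hn using Nat.le_induction with
  | base =>
    simp only [S_one, chi, F, Finset.Ico_self, Finset.sum_empty, pow_one]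
    field_simp; ring
  | succ n hn ih =>
    rw [S_succ _ hn, S_succ _ hn, chi_succ ψ hn hv]
    have hvn : v ^ n ≠ 0 := pow_ne_zero n hv
    have e : v * ((v * chi ψ n v ξ - 2 * v * F ψ n ξ - deriv (F ψ n) ξ
      - 2 * F ψ n ξ * S (fun s => F ψ s ξ) n v - F ψ n ξ ^ 2 / v ^ n) / v ^ (n + 1)) =
      v * (chi ψ n v ξ / v ^ n) - (2 * v * F ψ n ξ + deriv (F ψ n) ξ
      + 2 * F ψ n ξ * S (fun s => F ψ s ξ) n v + F ψ n ξ ^ 2 / v ^ n) / v ^ n := by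
      rw [pow_succ]; field_simp; ring
    rw [e]
    linear_combination ih

/-! ### Differential equations satisfied by the Liouville–Green approximation. -/

/-- The Liouville–Green approximation of order `n`, normalized at infinity. -/
noncomputable def lgApprox (E : ℕ → ℂ → ℂ) (Eα : ℕ → ℂ) (n : ℕ) (v ξ : ℂ) : ℂ :=
  Complex.exp (S (fun s => E s ξ) n v - S Eα n v) * Complex.exp (v * ξ)

section

variable {Δ : Set ℂ} {ψ : ℂ → ℂ} {E : ℕ → ℂ → ℂ}

/-- Being the derivative of the holomorphic `E s`, `F ψ s` is holomorphic; no induction along the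
recursion is needed. -/
theorem differentiableOn_F (hΔ : IsOpen Δ)
    (hE : ∀ s, 1 ≤ s → ∀ ξ ∈ Δ, HasDerivAt (E s) (F ψ s ξ) ξ) {s : ℕ} (hs : 1 ≤ s) :
    DifferentiableOn ℂ (F ψ s) Δ := by
  have h : DifferentiableOn ℂ (E s) Δ :=
    fun ξ hξ => (hE s hs ξ hξ).differentiableAt.differentiableWithinAt
  exact (h.deriv hΔ).congr fun ξ hξ => (hE s hs ξ hξ).deriv.symm

theorem hasDerivAt_S {e e' : ℕ → ℂ → ℂ} {ξ : ℂ} (n : ℕ) (v : ℂ)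
    (h : ∀ s, 1 ≤ s → HasDerivAt (e s) (e' s ξ) ξ) :
    HasDerivAt (fun ξ => S (fun s => e s ξ) n v) (S (fun s => e' s ξ) n v) ξ := by
  unfold S
  exact HasDerivAt.fun_sum fun s hs => (h s (Finset.mem_Ico.1 hs).1).div_const _

theorem continuousOn_T (hΔ : IsOpen Δ)
    (hE : ∀ s, 1 ≤ s → ∀ ξ ∈ Δ, HasDerivAt (E s) (F ψ s ξ) ξ) (n : ℕ) (v : ℂ) :
    ContinuousOn (T ψ n v) Δ := by
  unfold T
  exact continuousOn_finsetSum _ fun s _ =>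
    ((differentiableOn_F hΔ hE (by omega)).continuousOn).div_const _

theorem continuousOn_chi (hΔ : IsOpen Δ)
    (hE : ∀ s, 1 ≤ s → ∀ ξ ∈ Δ, HasDerivAt (E s) (F ψ s ξ) ξ) {n : ℕ} (hn : 1 ≤ n) (v : ℂ) :
    ContinuousOn (chi ψ n v) Δ := by
  unfold chi G
  refine (continuousOn_const.mul (differentiableOn_F hΔ hE hn).continuousOn).sub
    (continuousOn_finsetSum _ fun s hs => ContinuousOn.div_const
      (continuousOn_finsetSum _ fun k hk => ?_) _)
  have h1 := Finset.mem_Ico.1 hs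
  have h2 := Finset.mem_Ico.1 hk
  exact (differentiableOn_F hΔ hE (by omega)).continuousOn.mul
    (differentiableOn_F hΔ hE (by omega)).continuousOn

theorem lgApprox_ne_zero (E : ℕ → ℂ → ℂ) (Eα : ℕ → ℂ) (n : ℕ) (v ξ : ℂ) :
    lgApprox E Eα n v ξ ≠ 0 :=
  mul_ne_zero (Complex.exp_ne_zero _) (Complex.exp_ne_zero _)

theorem hasDerivAt_lgApprox (hE : ∀ s, 1 ≤ s → ∀ ξ ∈ Δ, HasDerivAt (E s) (F ψ s ξ) ξ)
    (Eα : ℕ → ℂ) (n : ℕ) (v : ℂ) {ξ : ℂ} (hξ : ξ ∈ Δ) :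
    HasDerivAt (lgApprox E Eα n v) ((v + T ψ n v ξ / v) * lgApprox E Eα n v ξ) ξ := by
  have h1 := ((hasDerivAt_S (e' := F ψ) n v fun s hs => hE s hs ξ hξ).sub_const (S Eα n v)).cexp
  have h2 : HasDerivAt (fun y => Complex.exp (v * y)) (Complex.exp (v * ξ) * v) ξ := by
    simpa using ((hasDerivAt_id ξ).const_mul v).cexp
  refine (h1.mul h2).congr_deriv ?_
  rw [T_div, lgApprox]; ring

/-- From `Y' = (v + σ) Y` follows `Y'' = ((v + σ)' + (v + σ)²) Y`, and `riccati` evaluates the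
bracket. -/
theorem hasDerivAt_deriv_lgApprox (hΔ : IsOpen Δ)
    (hE : ∀ s, 1 ≤ s → ∀ ξ ∈ Δ, HasDerivAt (E s) (F ψ s ξ) ξ)
    (Eα : ℕ → ℂ) {n : ℕ} (hn : 1 ≤ n) {v : ℂ} (hv : v ≠ 0) {ξ : ℂ} (hξ : ξ ∈ Δ) :
    HasDerivAt (fun ξ => (v + T ψ n v ξ / v) * lgApprox E Eα n v ξ)
      ((v ^ 2 + ψ ξ - v * (chi ψ n v ξ / v ^ n)) * lgApprox E Eα n v ξ) ξ := by
  have hF : ∀ s, 1 ≤ s → HasDerivAt (F ψ s) ((fun s ξ => deriv (F ψ s) ξ) s ξ) ξ := fun s hs =>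
    ((differentiableOn_F hΔ hE hs).differentiableAt (hΔ.mem_nhds hξ)).hasDerivAt
  have h1 := (hasDerivAt_S n v hF).const_add v
  have h2 : HasDerivAt (fun ξ => v + T ψ n v ξ / v) (S (fun s => deriv (F ψ s) ξ) n v) ξ := by
    simpa only [T_div] using h1
  refine (h2.mul (hasDerivAt_lgApprox hE Eα n v hξ)).congr_deriv ?_
  rw [T_div]
  linear_combination lgApprox E Eα n v ξ * riccati ψ hn hv ξ

end

/-! ### Comparison of exact with approximate solutions, and existence at infinity. -/

/-- `Y` is a nonvanishing approximate solution of `W'' = Q W`, namely `Y' = (v + p) Y` and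
`Y'' = (Q - v q) Y`, with continuous `p` and `q`. -/
structure IsApproxSolution (Δ : Set ℂ) (v : ℂ) (Q p q Y : ℂ → ℂ) : Prop where
  ne_zero : ∀ z, Y z ≠ 0
  continuousOn_p : ContinuousOn p Δ
  continuousOn_q : ContinuousOn q Δ
  hasDerivAt : ∀ z ∈ Δ, HasDerivAt Y ((v + p z) * Y z) z
  hasDerivAt_deriv : ∀ z ∈ Δ, HasDerivAt (fun z => (v + p z) * Y z) ((Q z - v * q z) * Y z) z

/-- The derivative of the quotient `W / Y` when `Y' = (v + p) Y`. -/
noncomputable def quotDeriv (v : ℂ) (p Y W W' : ℂ → ℂ) (z : ℂ) : ℂ :=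
  (W' z - (v + p z) * W z) / Y z

namespace IsApproxSolution

variable {Δ : Set ℂ} {v : ℂ} {Q p q Y : ℂ → ℂ}

theorem hasDerivAt_div (hY : IsApproxSolution Δ v Q p q Y) {W W' : ℂ → ℂ}
    (hW : ∀ z ∈ Δ, HasDerivAt W (W' z) z) {z : ℂ} (hz : z ∈ Δ) :
    HasDerivAt (fun z => W z / Y z) (quotDeriv v p Y W W' z) z := by
  refine ((hW z hz).div (hY.hasDerivAt z hz) (hY.ne_zero z)).congr_deriv ?_
  have := hY.ne_zero z
  rw [quotDeriv]; field_simp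

theorem hasDerivAt_quotDeriv (hY : IsApproxSolution Δ v Q p q Y) {W W' : ℂ → ℂ}
    (hW : ∀ z ∈ Δ, HasDerivAt W (W' z) z) (hW' : ∀ z ∈ Δ, HasDerivAt W' (Q z * W z) z)
    {z : ℂ} (hz : z ∈ Δ) :
    HasDerivAt (quotDeriv v p Y W W')
      (v * q z * (W z / Y z) - 2 * (v + p z) * quotDeriv v p Y W W' z) z := by
  -- Written as a Wronskian over `Y²`, the quotient is differentiated through `Y'` as a whole, so
  -- `p` itself need not be differentiable.
  have h0 : quotDeriv v p Y W W' =
      fun z => (W' z * Y z - W z * ((v + p z) * Y z)) / (Y z * Y z) := by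
    funext z
    have := hY.ne_zero z
    rw [quotDeriv]; field_simp
  have h1 := hY.ne_zero z
  rw [h0]
  refine ((((hW' z hz).mul (hY.hasDerivAt z hz)).sub ((hW z hz).mul (hY.hasDerivAt_deriv z hz))).div
    ((hY.hasDerivAt z hz).mul (hY.hasDerivAt z hz)) (mul_ne_zero h1 h1)).congr_deriv ?_
  simp only [Pi.mul_apply, Pi.sub_apply]
  field_simp
  ring

theorem quotDeriv_add (a b : ℂ) (W W' V V' : ℂ → ℂ) (z : ℂ) :
    quotDeriv v p Y (fun z => a * W z + b * V z) (fun z => a * W' z + b * V' z) z =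
      a * quotDeriv v p Y W W' z + b * quotDeriv v p Y V V' z := by
  simp only [quotDeriv]; ring

variable {γ : ℝ → ℂ} {s : Set ℝ}

/-- Finite-interval form of the error bound. -/
theorem norm_quot_sub_one_le (hY : IsApproxSolution Δ v Q p q Y) (hγ : IsPiecewiseC1 γ s)
    (hmem : ∀ t, 0 ≤ t → γ t ∈ Δ) (hv : v ≠ 0)
    (hmono : AntitoneOn (fun t => (v * γ t).re) (Ici 0))
    (hp : ArcConverges p γ) (hq : ArcConverges q γ) {W W' : ℂ → ℂ}
    (hW : ∀ z ∈ Δ, HasDerivAt W (W' z) z) (hW' : ∀ z ∈ Δ, HasDerivAt W' (Q z * W z) z)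
    {t N : ℝ} (ht : 0 ≤ t) (htN : t ≤ N) (hN : W (γ N) = Y (γ N))
    (hN' : W' (γ N) = (v + p (γ N)) * Y (γ N)) :
    let K := (∫ x in Ioi t, ‖q (γ x)‖ * ‖deriv γ x‖) * Real.exp (2 * arcInt p γ + arcInt q γ)
    ‖W (γ t) / Y (γ t) - 1‖ ≤ K ∧ ‖quotDeriv v p Y W W' (γ t) / v‖ ≤ K ∧
      ‖W (γ t) / Y (γ t) - 1 + quotDeriv v p Y W W' (γ t) / v‖ ≤ K := by
  intro K
  have h := norm_perturbation_le hγ hmem hv hmono hY.continuousOn_p hY.continuousOn_q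
    (h := fun z => W z / Y z - 1) (h' := quotDeriv v p Y W W')
    (fun z hz => (hY.hasDerivAt_div hW hz).sub_const 1)
    (fun z hz => (hY.hasDerivAt_quotDeriv hW hW' hz).congr_deriv (by ring)) ht htN
    (by rw [hN, div_self (hY.ne_zero _), sub_self])
    (by rw [quotDeriv, hN, hN', sub_self, zero_div])
  have hle : ∀ {f : ℝ → ℝ} {a b : ℝ}, (∀ x, 0 ≤ f x) → IntegrableOn f (Ioi a) → a ≤ b →
      ∫ x in a..b, f x ≤ ∫ x in Ioi a, f x := by
    intro f a b hf hi hab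
    rw [intervalIntegral.integral_of_le hab]
    exact setIntegral_mono_set hi (Eventually.of_forall hf) (Ioc_subset_Ioi_self.eventuallyLE)
  have hle0 : ∀ {f : ℝ → ℝ}, (∀ x, 0 ≤ f x) → IntegrableOn f (Ioi 0) →
      ∫ x in t..N, f x ≤ ∫ x in Ioi 0, f x := by
    intro f hf hi
    refine (hle hf (hi.mono_set (Ioi_subset_Ioi ht)) htN).trans ?_
    exact setIntegral_mono_set hi (Eventually.of_forall hf) (Ioi_subset_Ioi ht).eventuallyLE
  have hK : (∫ t in t..N, ‖q (γ t)‖ * ‖deriv γ t‖) *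
      Real.exp (∫ t in t..N, (2 * (‖p (γ t)‖ * ‖deriv γ t‖) + ‖q (γ t)‖ * ‖deriv γ t‖)) ≤ K := by
    refine mul_le_mul (hle (fun x => by positivity) (hq.mono_set (Ioi_subset_Ioi ht)) htN)
      (Real.exp_le_exp.2 ?_) (Real.exp_pos _).le
      (integral_nonneg fun x => by positivity)
    rw [intervalIntegral.integral_add
      ((hγ.intervalIntegrable_norm_mul hmem hY.continuousOn_p ht (ht.trans htN)).const_mul 2)
      (hγ.intervalIntegrable_norm_mul hmem hY.continuousOn_q ht (ht.trans htN)),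
      intervalIntegral.integral_const_mul]
    have h1 := hle0 (fun x => by positivity) hp
    have h2 := hle0 (fun x => by positivity) hq
    unfold arcInt
    linarith
  exact ⟨h.1.trans hK, h.2.1.trans hK, h.2.2.trans hK⟩

/-- Existence of the solution that is asymptotic to `Y` at the infinite end of `γ`. -/
theorem exists_recessive (hY : IsApproxSolution Δ v Q p q Y) (hΔ : IsOpen Δ)
    (hΔc : IsSimplyConnected Δ) (hQ : DifferentiableOn ℂ Q Δ) (hγ : IsPiecewiseC1 γ s)
    (hmem : ∀ t, 0 ≤ t → γ t ∈ Δ) (hv : v ≠ 0)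
    (hmono : AntitoneOn (fun t => (v * γ t).re) (Ici 0))
    (hp : ArcConverges p γ) (hq : ArcConverges q γ) :
    ∃ W W' : ℂ → ℂ, (∀ z ∈ Δ, HasDerivAt W (W' z) z) ∧
      (∀ z ∈ Δ, HasDerivAt W' (Q z * W z) z) ∧ ∀ t, 0 ≤ t →
      let K := (∫ x in Ioi t, ‖q (γ x)‖ * ‖deriv γ x‖) * Real.exp (2 * arcInt p γ + arcInt q γ)
      ‖W (γ t) / Y (γ t) - 1‖ ≤ K ∧ ‖quotDeriv v p Y W W' (γ t) / v‖ ≤ K ∧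
        ‖W (γ t) / Y (γ t) - 1 + quotDeriv v p Y W W' (γ t) / v‖ ≤ K := by
  have h0Δ : γ 0 ∈ Δ := hmem 0 le_rfl
  obtain ⟨w, w', hw, hw', hw0, hw0'⟩ := exists_global_solution hΔ hΔc hQ h0Δ 1 0
  obtain ⟨x, x', hx, hx', hx0, hx0'⟩ := exists_global_solution hΔ hΔc hQ h0Δ 0 1
  have hwr : ∀ z ∈ Δ, w z * x' z - w' z * x z = 1 := fun z hz => by
    rw [wronskian_eq hΔ hΔc.isPathConnected.isConnected.isPreconnected hw hw' hx hx' hz h0Δ,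
      hw0, hw0', hx0, hx0']
    ring
  have hsol : ∀ a b : ℂ, (∀ z ∈ Δ, HasDerivAt (fun z => a * w z + b * x z)
      (a * w' z + b * x' z) z) ∧ (∀ z ∈ Δ, HasDerivAt (fun z => a * w' z + b * x' z)
      (Q z * (a * w z + b * x z)) z) := fun a b =>
    ⟨fun z hz => ((hw z hz).const_mul a).add ((hx z hz).const_mul b), fun z hz =>
      (((hw' z hz).const_mul a).add ((hx' z hz).const_mul b)).congr_deriv (by ring)⟩
  -- Cramer's rule again: the combination of `w` and `x` with the same value and derivative as `Y`
  -- at `γ N`.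
  let c : ℕ → ℂ × ℂ := fun N =>
    (Y (γ N) * x' (γ N) - (v + p (γ N)) * Y (γ N) * x (γ N),
      w (γ N) * ((v + p (γ N)) * Y (γ N)) - w' (γ N) * Y (γ N))
  have hcN : ∀ N : ℕ, (c N).1 * w (γ N) + (c N).2 * x (γ N) = Y (γ N) := fun N => by
    simp only [c]
    linear_combination Y (γ N) * hwr (γ N) (hmem N N.cast_nonneg)
  have hcN' : ∀ N : ℕ, (c N).1 * w' (γ N) + (c N).2 * x' (γ N) = (v + p (γ N)) * Y (γ N) :=
    fun N => by
      simp only [c]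
      linear_combination (v + p (γ N)) * Y (γ N) * hwr (γ N) (hmem N N.cast_nonneg)
  have hbound := fun (N : ℕ) (t : ℝ) (ht : 0 ≤ t) (htN : t ≤ N) =>
    hY.norm_quot_sub_one_le hγ hmem hv hmono hp hq (hsol (c N).1 (c N).2).1
      (hsol (c N).1 (c N).2).2 ht htN (hcN N) (hcN' N)
  set K : ℝ → ℝ := fun t =>
    (∫ x in Ioi t, ‖q (γ x)‖ * ‖deriv γ x‖) * Real.exp (2 * arcInt p γ + arcInt q γ)
  -- `w` and `x` are normalized at `γ 0`, so `c N` is the initial data there, which the error bound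
  -- at `t = 0` controls uniformly in `N`.
  have hbdd : ∃ C, ∀ N, c N ∈ Metric.closedBall (0 : ℂ × ℂ) C := by
    refine ⟨max (‖Y (γ 0)‖ * (1 + K 0))
      (‖Y (γ 0)‖ * (‖v‖ * K 0) + ‖v + p (γ 0)‖ * (‖Y (γ 0)‖ * (1 + K 0))), fun N => ?_⟩
    obtain ⟨h1, h2, -⟩ := hbound N 0 le_rfl N.cast_nonneg
    have hY0 := hY.ne_zero (γ 0)
    simp only [quotDeriv, hw0, hw0', hx0, hx0', mul_one, mul_zero, add_zero, zero_add] at h1 h2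
    have e1 : (c N).1 = Y (γ 0) * (1 + ((c N).1 / Y (γ 0) - 1)) := by field_simp; ring
    have b1 : ‖(c N).1‖ ≤ ‖Y (γ 0)‖ * (1 + K 0) := by
      rw [e1, norm_mul]
      gcongr
      refine (norm_add_le _ _).trans ?_
      rw [norm_one]
      gcongr
    have e2 : (c N).2 = Y (γ 0) * (v * (((c N).2 - (v + p (γ 0)) * (c N).1) / Y (γ 0) / v))
        + (v + p (γ 0)) * (c N).1 := by field_simp; ring
    have b2 : ‖(c N).2‖ ≤ ‖Y (γ 0)‖ * (‖v‖ * K 0)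
        + ‖v + p (γ 0)‖ * (‖Y (γ 0)‖ * (1 + K 0)) := by
      rw [e2]
      refine (norm_add_le _ _).trans ?_
      rw [norm_mul, norm_mul, norm_mul]
      gcongr
    rw [mem_closedBall_zero_iff, Prod.norm_def]
    exact max_le_max b1 b2
  obtain ⟨C, hC⟩ := hbdd
  obtain ⟨⟨a, b⟩, -, φ, hφ, hlim⟩ := tendsto_subseq_of_bounded Metric.isBounded_closedBall hC
  have hla : Tendsto (fun N => (c (φ N)).1) atTop (𝓝 a) :=
    (continuous_fst.tendsto _).comp hlim
  have hlb : Tendsto (fun N => (c (φ N)).2) atTop (𝓝 b) :=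
    (continuous_snd.tendsto _).comp hlim
  refine ⟨_, _, (hsol a b).1, (hsol a b).2, fun t ht => ?_⟩
  have hev : ∀ᶠ N in atTop, t ≤ (φ N : ℕ) := by
    filter_upwards [eventually_ge_atTop ⌈t⌉₊] with N hN
    exact (Nat.le_ceil t).trans (Nat.cast_le.2 (hN.trans (hφ.id_le N)))
  have l1 : Tendsto (fun N => ((c (φ N)).1 * w (γ t) + (c (φ N)).2 * x (γ t)) / Y (γ t) - 1)
      atTop (𝓝 ((a * w (γ t) + b * x (γ t)) / Y (γ t) - 1)) :=
    (((hla.mul_const _).add (hlb.mul_const _)).div_const _).sub_const _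
  have l2 : Tendsto (fun N => quotDeriv v p Y (fun z => (c (φ N)).1 * w z + (c (φ N)).2 * x z)
      (fun z => (c (φ N)).1 * w' z + (c (φ N)).2 * x' z) (γ t) / v) atTop
      (𝓝 (quotDeriv v p Y (fun z => a * w z + b * x z) (fun z => a * w' z + b * x' z) (γ t) / v)) := by
    simp only [quotDeriv_add]
    exact ((hla.mul_const _).add (hlb.mul_const _)).div_const _
  refine ⟨le_of_tendsto l1.norm ?_, le_of_tendsto l2.norm ?_,
    le_of_tendsto (l1.add l2).norm ?_⟩ <;> filter_upwards [hev] with N hN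
  · exact (hbound (φ N) t ht hN).1
  · exact (hbound (φ N) t ht hN).2.1
  · exact (hbound (φ N) t ht hN).2.2

end IsApproxSolution

/-! ### Recessive solutions are proportional. -/

/-- Two solutions with vanishing Wronskian are proportional. -/
theorem eq_const_mul_of_wronskian_eq_zero {Δ : Set ℂ} (hΔ : IsOpen Δ) (hΔc : IsPreconnected Δ)
    {W W' V V' : ℂ → ℂ} (hW : ∀ z ∈ Δ, HasDerivAt W (W' z) z)
    (hV : ∀ z ∈ Δ, HasDerivAt V (V' z) z) (h : ∀ z ∈ Δ, W z * V' z - W' z * V z = 0)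
    {c : ℂ} (hc : c ∈ Δ) (hWc : W c ≠ 0) : ∀ z ∈ Δ, V z = V c / W c * W z := by
  have hWd : DifferentiableOn ℂ W Δ :=
    fun z hz => (hW z hz).differentiableAt.differentiableWithinAt
  have hVd : DifferentiableOn ℂ V Δ :=
    fun z hz => (hV z hz).differentiableAt.differentiableWithinAt
  -- `W` may vanish elsewhere in `Δ`, so `V / W` is shown constant only near `c`; the identity
  -- theorem does the rest.
  have hnhds : Δ ∩ {z | W z ≠ 0} ∈ 𝓝 c :=
    inter_mem (hΔ.mem_nhds hc) ((hW c hc).continuousAt.eventually_ne hWc)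
  obtain ⟨r, hr, hsub⟩ := Metric.mem_nhds_iff.1 hnhds
  have hquot : ∀ z ∈ Metric.ball c r, HasDerivAt (fun z => V z / W z) 0 z := fun z hz => by
    refine ((hV z (hsub hz).1).div (hW z (hsub hz).1) (hsub hz).2).congr_deriv ?_
    have := h z (hsub hz).1
    rw [show V' z * W z - V z * W' z = 0 by linear_combination this, zero_div]
  have hev : V =ᶠ[𝓝 c] fun z => V c / W c * W z := by
    filter_upwards [Metric.ball_mem_nhds c hr] with z hz
    have := Metric.isOpen_ball.is_const_of_deriv_eq_zero (convex_ball c r).isPreconnected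
      (fun z hz => (hquot z hz).differentiableAt.differentiableWithinAt)
      (fun z hz => (hquot z hz).deriv) hz (Metric.mem_ball_self hr)
    have hWz : W z ≠ 0 := (hsub hz).2
    rw [← this]; field_simp
  exact (hVd.analyticOnNhd hΔ).eqOn_of_preconnected_of_eventuallyEq
    ((hWd.const_mul _).analyticOnNhd hΔ) hΔc hc hev

namespace IsApproxSolution

variable {Δ : Set ℂ} {v : ℂ} {Q p q Y : ℂ → ℂ} {γ : ℝ → ℂ} {s : Set ℝ}

/-- A solution that tends to zero along `γ` has zero Wronskian with the recessive one. -/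
theorem wronskian_eq_zero (hY : IsApproxSolution Δ v Q p q Y) (hΔ : IsOpen Δ)
    (hΔc : IsPreconnected Δ) (hγ : IsPiecewiseC1 γ s)
    (hmem : ∀ t, 0 ≤ t → γ t ∈ Δ) (hv : v ≠ 0)
    (hmono : AntitoneOn (fun t => (v * γ t).re) (Ici 0))
    (hinf : Tendsto (fun t => Complex.exp (v * γ t)) atTop (𝓝 0))
    (hnorm : Tendsto (fun t => Y (γ t) * Complex.exp (-(v * γ t))) atTop (𝓝 1))
    (hp : ArcConverges p γ) (hq : ArcConverges q γ) {W W' V V' : ℂ → ℂ}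
    (hW : ∀ z ∈ Δ, HasDerivAt W (W' z) z) (hW' : ∀ z ∈ Δ, HasDerivAt W' (Q z * W z) z)
    (hWlim : Tendsto (fun t => W (γ t) / Y (γ t)) atTop (𝓝 1))
    (hWlim' : Tendsto (fun t => quotDeriv v p Y W W' (γ t)) atTop (𝓝 0))
    (hV : ∀ z ∈ Δ, HasDerivAt V (V' z) z) (hV' : ∀ z ∈ Δ, HasDerivAt V' (Q z * V z) z)
    (hVlim : Tendsto (fun t => V (γ t)) atTop (𝓝 0)) :
    ∀ z ∈ Δ, W z * V' z - W' z * V z = 0 := by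
  intro z hz
  set κ : ℂ := W z * V' z - W' z * V z with hκdef
  have hκ : ∀ t, 0 ≤ t → W (γ t) * V' (γ t) - W' (γ t) * V (γ t) = κ := fun t ht =>
    wronskian_eq hΔ hΔc hW hW' hV hV' (hmem t ht) hz
  set k : ℂ → ℂ := fun z => V z / Y z
  set k' : ℂ → ℂ := quotDeriv v p Y V V'
  set e : ℝ → ℂ := fun t => Complex.exp (2 * v * γ t)
  have hexp : ∀ t, e t = Complex.exp (v * γ t) * Complex.exp (v * γ t) := fun t => by
    simp only [e]; rw [← Complex.exp_add]; ring_nf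
  have hneg : ∀ t, Complex.exp (v * γ t) * Complex.exp (-(v * γ t)) = 1 := fun t => by
    rw [← Complex.exp_add, add_neg_cancel, Complex.exp_zero]
  have hek : Tendsto (fun t => e t * k (γ t)) atTop (𝓝 0) := by
    have h1 := (hinf.mul hVlim).div hnorm one_ne_zero
    rw [mul_zero, zero_div] at h1
    refine h1.congr fun t => ?_
    have := hY.ne_zero (γ t)
    have h2 := Complex.exp_ne_zero (-(v * γ t))
    simp only [Pi.div_apply, k]
    rw [hexp]
    field_simp
    linear_combination -V (γ t) * hneg t
  -- With `g = W / Y`, `κ = Y² (g k' - g' k)`. Here `e / Y² → 1`, `g → 1`, `g' → 0` and `e k → 0`.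
  have hek' : Tendsto (fun t => e t * k' (γ t)) atTop (𝓝 κ) := by
    have h1 := ((tendsto_const_nhds (x := κ)).div (hnorm.mul hnorm) (by norm_num)).add
      (hWlim'.mul hek)
    have h2 := h1.div hWlim one_ne_zero
    rw [mul_one, div_one, zero_mul, add_zero, div_one] at h2
    refine h2.congr' ?_
    filter_upwards [hWlim.eventually_ne one_ne_zero, eventually_ge_atTop 0] with t ht ht0
    have hYt := hY.ne_zero (γ t)
    have h3 := Complex.exp_ne_zero (-(v * γ t))
    simp only [Pi.div_apply, k, k', quotDeriv]
    rw [← hκ t ht0, hexp, eq_inv_of_mul_eq_one_left (hneg t)]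
    have hWt : W (γ t) ≠ 0 := fun h => ht (by rw [h, zero_div])
    field_simp
    ring
  set R : ℂ → ℂ := fun z => (v * q z * k z - 2 * p z * k' z) / (2 * v)
  have hkd : ∀ z ∈ Δ, HasDerivAt k (k' z) z := fun z hz => hY.hasDerivAt_div hV hz
  have hkd' : ∀ z ∈ Δ, HasDerivAt k' (v * q z * k z - 2 * (v + p z) * k' z) z :=
    fun z hz => hY.hasDerivAt_quotDeriv hV hV' hz
  have hkc : ContinuousOn k Δ := fun z hz => (hkd z hz).continuousAt.continuousWithinAt
  have hkc' : ContinuousOn k' Δ := fun z hz => (hkd' z hz).continuousAt.continuousWithinAt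
  have hpc := hY.continuousOn_p
  have hqc := hY.continuousOn_q
  have hRc : ContinuousOn R Δ := by fun_prop
  have had : ∀ z ∈ Δ, HasDerivAt (fun z => k z + k' z / (2 * v)) (R z) z := fun z hz =>
    ((hkd z hz).add ((hkd' z hz).div_const (2 * v))).congr_deriv (by
      simp only [R]; field_simp; ring)
  have hea : Tendsto (fun t => e t * (k (γ t) + k' (γ t) / (2 * v))) atTop
      (𝓝 (κ / (2 * v))) := by
    have := hek.add (hek'.div_const (2 * v))
    rw [zero_add] at this
    refine this.congr fun t => ?_
    ring
  have hvn : 0 < ‖v‖ := norm_pos_iff.2 hv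
  set M : ℝ := (‖κ‖ + 1) / ‖v‖
  have hM : 0 ≤ M := by positivity
  set g : ℝ → ℝ := fun x => M * (‖p (γ x)‖ * ‖deriv γ x‖) + ‖q (γ x)‖ * ‖deriv γ x‖
  have hg : IntegrableOn g (Ioi 0) := (Integrable.const_mul hp M).add hq
  have hg0 : ∀ x, 0 ≤ g x := fun x => by positivity
  have hRb : ∀ᶠ x in atTop, ‖e x‖ * (‖R (γ x)‖ * ‖deriv γ x‖) ≤ g x := by
    have h1 : ∀ᶠ x in atTop, ‖e x * k (γ x)‖ < 1 := hek.norm.eventually_lt_const (by simp)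
    have h2 : ∀ᶠ x in atTop, ‖e x * k' (γ x)‖ < ‖κ‖ + 1 :=
      hek'.norm.eventually_lt_const (by simp)
    filter_upwards [h1, h2] with x h1 h2
    have e1 : e x * R (γ x) = q (γ x) * (e x * k (γ x)) / 2 - p (γ x) * (e x * k' (γ x)) / v := by
      simp only [R]; field_simp
    have h3 : ‖e x * R (γ x)‖ ≤ ‖q (γ x)‖ + M * ‖p (γ x)‖ := by
      rw [e1]
      refine (norm_sub_le _ _).trans (add_le_add ?_ ?_)
      · rw [norm_div, norm_mul, Complex.norm_ofNat]
        nlinarith [norm_nonneg (q (γ x)), norm_nonneg (e x * k (γ x))]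
      · rw [norm_div, norm_mul]
        calc _ ≤ ‖p (γ x)‖ * (‖κ‖ + 1) / ‖v‖ := by gcongr
          _ = M * ‖p (γ x)‖ := by simp only [M]; ring
    rw [norm_mul] at h3
    calc _ = ‖e x‖ * ‖R (γ x)‖ * ‖deriv γ x‖ := by ring
      _ ≤ (‖q (γ x)‖ + M * ‖p (γ x)‖) * ‖deriv γ x‖ := by gcongr
      _ = g x := by simp only [g]; ring
  obtain ⟨s₀, hs₀⟩ := eventually_atTop.1 hRb
  have he0 : Tendsto e atTop (𝓝 0) := by
    have := hinf.mul hinf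
    rw [mul_zero] at this
    exact this.congr fun t => (hexp t).symm
  -- `e (k + k'/(2v))` tends to `κ/(2v)`. The contribution of its value at `a` is killed by `e t →
  -- 0`, and the increment from `a` on is dominated by the integrable `g`; letting `a → ∞` gives `κ
  -- = 0`.
  have htail : ∀ a, 0 ≤ a → s₀ ≤ a → ‖κ / (2 * v)‖ ≤ ∫ x in Ioi a, g x := by
    intro a ha hsa
    have h1 : Tendsto (fun t => ‖e t‖ * ‖k (γ a) + k' (γ a) / (2 * v)‖ + ∫ x in Ioi a, g x) atTop
        (𝓝 (∫ x in Ioi a, g x)) := by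
      simpa using (he0.norm.mul_const ‖k (γ a) + k' (γ a) / (2 * v)‖).add_const (∫ x in Ioi a, g x)
    refine le_of_tendsto_of_tendsto hea.norm h1 ?_
    filter_upwards [eventually_ge_atTop a] with t hat
    have h2 := hγ.norm_sub_le hmem had hRc ha hat
    have h3 : ‖e t‖ * ∫ x in a..t, ‖R (γ x)‖ * ‖deriv γ x‖ ≤ ∫ x in a..t, g x := by
      rw [← intervalIntegral.integral_const_mul]
      refine intervalIntegral.integral_mono_on hat
        ((hγ.intervalIntegrable_norm_mul hmem hRc ha (ha.trans hat)).const_mul _)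
        ((intervalIntegrable_iff_integrableOn_Ioc_of_le hat).2
          (hg.mono_set (Ioc_subset_Ioi_self.trans (Ioi_subset_Ioi ha)))) fun x hx => ?_
      refine le_trans ?_ (hs₀ x (hsa.trans hx.1))
      have := norm_exp_two_mul_le hmono (ha.trans hx.1) hx.2
      gcongr
    have h4 : ∫ x in a..t, g x ≤ ∫ x in Ioi a, g x := by
      rw [intervalIntegral.integral_of_le hat]
      exact setIntegral_mono_set (hg.mono_set (Ioi_subset_Ioi ha)) (Eventually.of_forall hg0)
        Ioc_subset_Ioi_self.eventuallyLE
    rw [norm_mul]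
    have h5 : ‖k (γ t) + k' (γ t) / (2 * v)‖ ≤ ‖k (γ a) + k' (γ a) / (2 * v)‖
        + ∫ x in a..t, ‖R (γ x)‖ * ‖deriv γ x‖ := by
      have := norm_sub_norm_le (k (γ t) + k' (γ t) / (2 * v)) (k (γ a) + k' (γ a) / (2 * v))
      linarith
    have h6 := mul_le_mul_of_nonneg_left h5 (norm_nonneg (e t))
    linarith
  have hzero : ‖κ / (2 * v)‖ ≤ 0 := by
    refine ge_of_tendsto (tendsto_integral_Ioi_zero (f := g) (μ := volume) tendsto_id) ?_
    filter_upwards [eventually_ge_atTop 0, eventually_ge_atTop s₀] with a ha hsa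
    exact htail a ha hsa
  have h0 : κ / (2 * v) = 0 := norm_le_zero_iff.1 hzero
  have h2v : (2 * v) ≠ 0 := mul_ne_zero two_ne_zero hv
  exact (div_eq_zero_iff.1 h0).resolve_right h2v

end IsApproxSolution

/-! ### The normalized solution and its error bounds. -/

theorem IsSolution.hasDerivAt {Δ : Set ℂ} {ψ : ℂ → ℂ} {u : ℂ} {W : ℂ → ℂ} (hΔ : IsOpen Δ)
    (h : IsSolution Δ ψ u W) : (∀ z ∈ Δ, HasDerivAt W (deriv W z) z) ∧
      ∀ z ∈ Δ, HasDerivAt (deriv W) ((u ^ 2 + ψ z) * W z) z := by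
  refine ⟨fun z hz => (h.1.differentiableAt (hΔ.mem_nhds hz)).hasDerivAt, fun z hz => ?_⟩
  rw [← h.2 z hz]
  exact ((h.1.deriv hΔ).differentiableAt (hΔ.mem_nhds hz)).hasDerivAt

theorem isSolution_of_hasDerivAt {Δ : Set ℂ} {ψ : ℂ → ℂ} {u : ℂ} {W W' : ℂ → ℂ} (hΔ : IsOpen Δ)
    (h : ∀ z ∈ Δ, HasDerivAt W (W' z) z)
    (h' : ∀ z ∈ Δ, HasDerivAt W' ((u ^ 2 + ψ z) * W z) z) : IsSolution Δ ψ u W := by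
  refine ⟨fun z hz => (h z hz).differentiableAt.differentiableWithinAt, fun z hz => ?_⟩
  have hev : deriv W =ᶠ[𝓝 z] W' := by
    filter_upwards [hΔ.mem_nhds hz] with y hy using (h y hy).deriv
  rw [hev.deriv_eq, (h' z hz).deriv]

theorem isSolution_neg {Δ : Set ℂ} {ψ : ℂ → ℂ} {u : ℂ} {W : ℂ → ℂ} :
    IsSolution Δ ψ (-u) W ↔ IsSolution Δ ψ u W := by
  simp only [IsSolution, neg_sq]

theorem ArcConverges.div_const {f : ℂ → ℂ} {γ : ℝ → ℂ} (h : ArcConverges f γ) (c : ℂ) :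
    ArcConverges (fun z => f z / c) γ := by
  refine (Integrable.div_const h ‖c‖).congr (Eventually.of_forall fun t => ?_)
  simp only [norm_div]; ring

theorem arcInt_div_const (f : ℂ → ℂ) (γ : ℝ → ℂ) (c : ℂ) :
    arcInt (fun z => f z / c) γ = arcInt f γ / ‖c‖ := by
  unfold arcInt
  rw [← integral_div]
  refine integral_congr_ae (Eventually.of_forall fun t => ?_)
  simp only [norm_div]; ring

theorem arcInt_nonneg (f : ℂ → ℂ) (γ : ℝ → ℂ) : 0 ≤ arcInt f γ :=
  integral_nonneg fun t => by positivity

theorem S_sub_S (e : ℕ → ℂ) {n : ℕ} (hn : 1 ≤ n) (r : ℕ) (v : ℂ) :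
    S e (n + r) v - S e n v = ∑ s ∈ Finset.Ico n (n + r), e s / v ^ s := by
  rw [S, S, ← Finset.sum_Ico_consecutive _ hn (Nat.le_add_right n r)]; ring

section

variable {Δ : Set ℂ} {ψ : ℂ → ℂ} {E : ℕ → ℂ → ℂ}

theorem isApproxSolution_lgApprox (hΔ : IsOpen Δ)
    (hE : ∀ s, 1 ≤ s → ∀ ξ ∈ Δ, HasDerivAt (E s) (F ψ s ξ) ξ)
    (Eα : ℕ → ℂ) {n : ℕ} (hn : 1 ≤ n) {v : ℂ} (hv : v ≠ 0) :
    IsApproxSolution Δ v (fun ξ => v ^ 2 + ψ ξ) (fun ξ => T ψ n v ξ / v)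
      (fun ξ => chi ψ n v ξ / v ^ n) (lgApprox E Eα n v) where
  ne_zero := lgApprox_ne_zero E Eα n v
  continuousOn_p := (continuousOn_T hΔ hE n v).div_const v
  continuousOn_q := (continuousOn_chi hΔ hE hn v).div_const _
  hasDerivAt := fun _ hz => hasDerivAt_lgApprox hE Eα n v hz
  hasDerivAt_deriv := fun _ hz => hasDerivAt_deriv_lgApprox hΔ hE Eα hn hv hz

theorem tendsto_lgApprox_mul_exp {n : ℕ} {v : ℂ} {γ : ℝ → ℂ} {Eα : ℕ → ℂ}
    (h : Converges ψ E n v γ Eα) :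
    Tendsto (fun t => lgApprox E Eα n v (γ t) * Complex.exp (-(v * γ t))) atTop (𝓝 1) := by
  have h1 : Tendsto (fun t => S (fun s => E s (γ t)) n v) atTop (𝓝 (S Eα n v)) :=
    tendsto_finsetSum _ fun s hs => (h.E_lim s hs).div_const _
  have h2 := ((h1.sub_const (S Eα n v))).cexp
  rw [sub_self, Complex.exp_zero] at h2
  refine h2.congr fun t => ?_
  rw [lgApprox, mul_assoc, ← Complex.exp_add, add_neg_cancel, Complex.exp_zero, mul_one]

theorem IsProgressive.tendsto_exp {v : ℂ} {γ : ℝ → ℂ} (h : IsProgressive Δ v γ) :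
    Tendsto (fun t => Complex.exp (v * γ t)) atTop (𝓝 0) := by
  rw [tendsto_zero_iff_norm_tendsto_zero]
  simp only [Complex.norm_exp]
  exact Real.tendsto_exp_atBot.comp h.infinite

/-- Reduces uniqueness of the normalized solution to proportionality of recessive ones. -/
theorem tendsto_zero_of_normalized {v : ℂ} {γ : ℝ → ℂ} (h : IsProgressive Δ v γ) {V : ℂ → ℂ}
    (hV : Tendsto (fun t => V (γ t) * Complex.exp (-(v * γ t))) atTop (𝓝 1)) :
    Tendsto (fun t => V (γ t)) atTop (𝓝 0) := by
  have h1 := hV.mul h.tendsto_exp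
  rw [mul_zero] at h1
  refine h1.congr fun t => ?_
  rw [mul_assoc, ← Complex.exp_add, neg_add_cancel, Complex.exp_zero, mul_one]

/-- The normalized solution attached to the infinite end of a progressive path along which order
`n` converges: existence, error bounds at the initial point, and recessiveness. -/
theorem exists_normalized_of_converges (hΔ : IsOpen Δ) (hΔc : IsSimplyConnected Δ)
    (hψ : DifferentiableOn ℂ ψ Δ)
    (hE : ∀ s, 1 ≤ s → ∀ ξ ∈ Δ, HasDerivAt (E s) (F ψ s ξ) ξ) {v : ℂ} (hv : v ≠ 0)
    {γ : ℝ → ℂ} {Eα : ℕ → ℂ} (hγ : IsProgressive Δ v γ) {n : ℕ} (hn : 1 ≤ n)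
    (hconv : Converges ψ E n v γ Eα) :
    ∃ W, IsSolution Δ ψ v W ∧
      Tendsto (fun t => W (γ t) * Complex.exp (-(v * γ t))) atTop (𝓝 1) ∧
      (∀ V, IsSolution Δ ψ v V → Tendsto (fun t => V (γ t)) atTop (𝓝 0) →
        ∃ c : ℂ, ∀ ξ ∈ Δ, V ξ = c * W ξ) ∧
      let K := 1 / ‖v‖ ^ n * arcInt (chi ψ n v) γ * Real.exp (4 / ‖v‖ * arcInt (T ψ n v) γ
        + 1 / ‖v‖ ^ n * arcInt (chi ψ n v) γ)
      ‖W (γ 0) / lgApprox E Eα n v (γ 0) - 1‖ ≤ K ∧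
      ‖W (γ 0) / lgApprox E Eα n v (γ 0) - 1 + quotDeriv v (fun ξ => T ψ n v ξ / v)
        (lgApprox E Eα n v) W (deriv W) (γ 0) / v‖ ≤ K := by
  obtain ⟨s, hs⟩ := hγ.chain.isPiecewiseC1
  have hY := isApproxSolution_lgApprox hΔ hE Eα hn hv
  have hp := hconv.T_conv.div_const v
  have hq := hconv.chi_conv.div_const (v ^ n)
  have hQ : DifferentiableOn ℂ (fun ξ => v ^ 2 + ψ ξ) Δ := hψ.const_add _
  obtain ⟨W, W', hW, hW', hb⟩ := hY.exists_recessive hΔ hΔc hQ hs hγ.mem hv hγ.antitone hp hq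
  have hconn : IsPreconnected Δ := hΔc.isPathConnected.isConnected.isPreconnected
  have htail : Tendsto (fun t => (∫ x in Ioi t, ‖chi ψ n v (γ x) / v ^ n‖ * ‖deriv γ x‖) *
      Real.exp (2 * arcInt (fun ξ => T ψ n v ξ / v) γ
        + arcInt (fun ξ => chi ψ n v ξ / v ^ n) γ)) atTop (𝓝 0) := by
    have := (tendsto_integral_Ioi_zero (μ := volume)
      (f := fun x => ‖chi ψ n v (γ x) / v ^ n‖ * ‖deriv γ x‖) tendsto_id).mul_const
      (Real.exp (2 * arcInt (fun ξ => T ψ n v ξ / v) γ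
        + arcInt (fun ξ => chi ψ n v ξ / v ^ n) γ))
    rwa [zero_mul] at this
  have hlim : Tendsto (fun t => W (γ t) / lgApprox E Eα n v (γ t)) atTop (𝓝 1) := by
    have h1 : Tendsto (fun t => W (γ t) / lgApprox E Eα n v (γ t) - 1) atTop (𝓝 0) :=
      squeeze_zero_norm' (by
        filter_upwards [eventually_ge_atTop 0] with t ht using (hb t ht).1) htail
    simpa using h1.add_const 1
  have hlim' : Tendsto (fun t => quotDeriv v (fun ξ => T ψ n v ξ / v) (lgApprox E Eα n v) W W'
      (γ t)) atTop (𝓝 0) := by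
    have h1 : Tendsto (fun t => quotDeriv v (fun ξ => T ψ n v ξ / v) (lgApprox E Eα n v) W W'
      (γ t) / v) atTop (𝓝 0) :=
      squeeze_zero_norm' (by
        filter_upwards [eventually_ge_atTop 0] with t ht using (hb t ht).2.1) htail
    have h2 := h1.mul_const v
    rw [zero_mul] at h2
    exact h2.congr fun t => div_mul_cancel₀ _ hv
  have hnorm := tendsto_lgApprox_mul_exp hconv
  refine ⟨W, isSolution_of_hasDerivAt hΔ hW hW', ?_, ?_, ?_⟩
  · have h1 := hlim.mul hnorm
    rw [mul_one] at h1
    refine h1.congr fun t => ?_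
    have := lgApprox_ne_zero E Eα n v (γ t)
    field_simp
  · intro V hV hV0
    obtain ⟨hVd, hVd'⟩ := hV.hasDerivAt hΔ
    have hwr := hY.wronskian_eq_zero hΔ hconn hs hγ.mem hv hγ.antitone hγ.tendsto_exp hnorm hp hq
      hW hW' hlim hlim' hVd hVd' hV0
    obtain ⟨t, ht, ht0⟩ := ((hlim.eventually_ne one_ne_zero).and (eventually_ge_atTop 0)).exists
    have hWt : W (γ t) ≠ 0 := fun h => ht (by rw [h, zero_div])
    exact ⟨_, eq_const_mul_of_wronskian_eq_zero hΔ hconn hW hVd hwr (hγ.mem t ht0) hWt⟩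
  · have h0 := hb 0 le_rfl
    have hK : (∫ x in Ioi (0 : ℝ), ‖chi ψ n v (γ x) / v ^ n‖ * ‖deriv γ x‖) *
      Real.exp (2 * arcInt (fun ξ => T ψ n v ξ / v) γ
        + arcInt (fun ξ => chi ψ n v ξ / v ^ n) γ) ≤
      1 / ‖v‖ ^ n * arcInt (chi ψ n v) γ * Real.exp (4 / ‖v‖ * arcInt (T ψ n v) γ
        + 1 / ‖v‖ ^ n * arcInt (chi ψ n v) γ) := by
      have e1 := arcInt_div_const (chi ψ n v) γ (v ^ n)
      have e2 := arcInt_div_const (T ψ n v) γ v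
      rw [norm_pow] at e1
      have e3 : (∫ x in Ioi (0 : ℝ), ‖chi ψ n v (γ x) / v ^ n‖ * ‖deriv γ x‖) =
        1 / ‖v‖ ^ n * arcInt (chi ψ n v) γ := by
        rw [one_div_mul_eq_div]; exact e1
      have hT := arcInt_nonneg (T ψ n v) γ
      have hχ := arcInt_nonneg (chi ψ n v) γ
      rw [e3, e1, e2]
      gcongr ?_ * Real.exp (?_ + ?_)
      -- The argument yields the factor 2 in front of the integral of `T_n`; it is relaxed to the
      -- stated 4.
      · have : 0 ≤ arcInt (T ψ n v) γ / ‖v‖ := by positivity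
        calc _ ≤ 4 * (arcInt (T ψ n v) γ / ‖v‖) := by linarith
          _ = _ := by ring
      · rw [one_div_mul_eq_div]
    have hW0 : W' (γ 0) = deriv W (γ 0) := ((hW _ (hγ.mem 0 le_rfl)).deriv).symm
    have e4 : quotDeriv v (fun ξ => T ψ n v ξ / v) (lgApprox E Eα n v) W (deriv W) (γ 0) =
        quotDeriv v (fun ξ => T ψ n v ξ / v) (lgApprox E Eα n v) W W' (γ 0) := by
      rw [quotDeriv, quotDeriv, hW0]
    rw [e4]
    exact ⟨h0.1.trans hK, h0.2.2.trans hK⟩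

/-- The Liouville–Green theorem at the end where `Re (u ξ)` tends to `-∞`. -/
theorem exists_normalized_solution (hΔ : IsOpen Δ) (hΔc : IsSimplyConnected Δ)
    (hψ : DifferentiableOn ℂ ψ Δ)
    (hE : ∀ s, 1 ≤ s → ∀ ξ ∈ Δ, HasDerivAt (E s) (F ψ s ξ) ξ) {u : ℂ} (hu : u ≠ 0)
    (L : ℝ → ℂ) (Eα : ℕ → ℂ) (hL : IsProgressive Δ u L)
    (hconv : ∃ n, 1 ≤ n ∧ Converges ψ E n u L Eα) :
    ∃ (W : ℂ → ℂ) (ε : ℕ → ℂ → ℂ),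
      IsSolution Δ ψ u W ∧
      (∀ n, 1 ≤ n → ∀ ξ ∈ Δ,
        W ξ = Complex.exp (S (fun s => E s ξ) n u - S Eα n u)
          * (Complex.exp (u * ξ) + ε n ξ)) ∧
      Tendsto (fun t => W (L t) * Complex.exp (-(u * L t))) atTop (𝓝 1) ∧
      (∀ V, IsSolution Δ ψ u V →
        Tendsto (fun t => V (L t) * Complex.exp (-(u * L t))) atTop (𝓝 1) →
        EqOn V W Δ) ∧
      (∀ V, IsSolution Δ ψ u V → Tendsto (fun t => V (L t)) atTop (𝓝 0) →
        ∃ c : ℂ, ∀ ξ ∈ Δ, V ξ = c * W ξ) ∧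
      (∀ (ξ : ℂ) (γ : ℝ → ℂ), γ 0 = ξ → IsProgressive Δ u γ →
        (SameEnd γ L ∨
          Tendsto (fun t => W (γ t) * Complex.exp (-(u * γ t))) atTop (𝓝 1)) →
        ∀ n, 1 ≤ n →
          (Converges ψ E n u γ Eα →
            max ‖ε n ξ‖ ‖1 / u * deriv (ε n) ξ‖ ≤
              ‖Complex.exp (u * ξ) / u ^ n‖
                * arcInt (chi ψ n u) γ
                * Real.exp (4 / ‖u‖ * arcInt (T ψ n u) γ
                    + 1 / ‖u‖ ^ n * arcInt (chi ψ n u) γ)) ∧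
          (∀ r, 1 ≤ r → Converges ψ E (n + r) u γ Eα →
            ‖Complex.exp (-(u * ξ)) * ε n ξ‖ ≤
              ‖Complex.exp (∑ s ∈ Finset.Ico n (n + r), (E s ξ - Eα s) / u ^ s) - 1‖
              + 1 / ‖u‖ ^ (n + r)
                * arcInt (chi ψ (n + r) u) γ
                * Real.exp (4 / ‖u‖ * arcInt (T ψ (n + r) u) γ
                    + 1 / ‖u‖ ^ (n + r)
                      * arcInt (chi ψ (n + r) u) γ
                    + (∑ s ∈ Finset.Ico n (n + r), (E s ξ - Eα s) / u ^ s).re))) := by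
  obtain ⟨m, hm, hconv⟩ := hconv
  obtain ⟨W, hW, hWL, hrec, -⟩ := exists_normalized_of_converges hΔ hΔc hψ hE hu hL hm hconv
  have heq : ∀ (γ : ℝ → ℂ) (V X : ℂ → ℂ) (c : ℂ), IsProgressive Δ u γ →
      Tendsto (fun t => V (γ t) * Complex.exp (-(u * γ t))) atTop (𝓝 1) →
      Tendsto (fun t => X (γ t) * Complex.exp (-(u * γ t))) atTop (𝓝 1) →
      (∀ ξ ∈ Δ, V ξ = c * X ξ) → EqOn V X Δ := by
    intro γ V X c hγ hV hX h
    have h1 : Tendsto (fun t => V (γ t) * Complex.exp (-(u * γ t))) atTop (𝓝 (c * 1)) := by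
      refine (hX.const_mul c).congr' ?_
      filter_upwards [eventually_ge_atTop 0] with t ht
      rw [h _ (hγ.mem t ht), mul_assoc]
    have hc := tendsto_nhds_unique hV h1
    intro ξ hξ
    rw [h ξ hξ, ← mul_one c, ← hc, one_mul]
  -- The required representation of `W` forces this error term; it makes sense for every `n`,
  -- convergent or not.
  refine ⟨W, fun n ξ => Complex.exp (u * ξ) * (W ξ / lgApprox E Eα n u ξ - 1), hW, ?_, hWL, ?_,
    hrec, ?_⟩
  · intro n _ ξ _
    have h1 := Complex.exp_ne_zero (u * ξ)
    have h2 := Complex.exp_ne_zero (S (fun s => E s ξ) n u - S Eα n u)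
    simp only [lgApprox]; field_simp; ring
  · intro V hV hVL
    obtain ⟨c, hc⟩ := hrec V hV (tendsto_zero_of_normalized hL hVL)
    exact heq L V W c hL hVL hWL hc
  intro ξ γ hγξ hγ hend n hn
  subst hγξ
  have hWγ : Tendsto (fun t => W (γ t) * Complex.exp (-(u * γ t))) atTop (𝓝 1) := by
    rcases hend with ⟨a, b, ha, -, hab⟩ | h
    · have h1 := hWL.comp (tendsto_atTop_add_const_left atTop b (tendsto_atTop_add_const_left atTop
        (-a) tendsto_id))
      refine h1.congr' ?_
      filter_upwards [eventually_ge_atTop a] with t ht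
      have := hab (-a + t) (by linarith)
      rw [add_neg_cancel_left] at this
      simp only [Function.comp, id, this]
    · exact h
  -- Order `m` along `γ` produces its own normalized solution `X`. As `W` is normalized along `γ`
  -- too, `W = X`, so the bounds for `X` pass to `W`.
  have hbd : ∀ m, 1 ≤ m → Converges ψ E m u γ Eα →
      let K := 1 / ‖u‖ ^ m * arcInt (chi ψ m u) γ * Real.exp (4 / ‖u‖ * arcInt (T ψ m u) γ
        + 1 / ‖u‖ ^ m * arcInt (chi ψ m u) γ)
      ‖W (γ 0) / lgApprox E Eα m u (γ 0) - 1‖ ≤ K ∧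
      ‖W (γ 0) / lgApprox E Eα m u (γ 0) - 1 + quotDeriv u (fun ξ => T ψ m u ξ / u)
        (lgApprox E Eα m u) W (deriv W) (γ 0) / u‖ ≤ K := by
    intro m hm hc
    obtain ⟨X, hX, hXγ, hXrec, hXb⟩ :=
      exists_normalized_of_converges hΔ hΔc hψ hE hu hγ hm hc
    obtain ⟨c, hc⟩ := hXrec W hW (tendsto_zero_of_normalized hγ hWγ)
    have hWX := heq γ W X c hγ hWγ hXγ hc
    have h0 := hγ.mem 0 le_rfl
    have hd : deriv W (γ 0) = deriv X (γ 0) :=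
      (hWX.eventuallyEq_of_mem (hΔ.mem_nhds h0)).deriv_eq
    simpa only [quotDeriv, hWX h0, hd] using hXb
  refine ⟨fun hc => ?_, fun r hr hc => ?_⟩
  · obtain ⟨h1, h2⟩ := hbd n hn hc
    have hY := isApproxSolution_lgApprox hΔ hE Eα hn hu
    have h0 := hγ.mem 0 le_rfl
    have hexp : HasDerivAt (fun y => Complex.exp (u * y)) (Complex.exp (u * γ 0) * u) (γ 0) := by
      simpa using ((hasDerivAt_id (γ 0)).const_mul u).cexp
    have hder := hexp.mul ((hY.hasDerivAt_div (hW.hasDerivAt hΔ).1 h0).sub_const 1)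
    have e1 : 1 / u * deriv (fun ξ => Complex.exp (u * ξ) * (W ξ / lgApprox E Eα n u ξ - 1)) (γ 0)
        = Complex.exp (u * γ 0) * (W (γ 0) / lgApprox E Eα n u (γ 0) - 1
          + quotDeriv u (fun ξ => T ψ n u ξ / u) (lgApprox E Eα n u) W (deriv W) (γ 0) / u) := by
      have := hder.deriv
      simp only [Pi.mul_def] at this
      rw [this]
      field_simp
    have e2 : ∀ a b : ℝ, ‖Complex.exp (u * γ 0) / u ^ n‖ * a * b =
        ‖Complex.exp (u * γ 0)‖ * (1 / ‖u‖ ^ n * a * b) := fun a b => by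
      rw [norm_div, norm_pow]; ring
    rw [e1, e2]
    beta_reduce
    rw [norm_mul, norm_mul]
    exact max_le (by gcongr) (by gcongr)
  · obtain ⟨h1, -⟩ := hbd (n + r) (by omega) hc
    set D : ℂ := ∑ s ∈ Finset.Ico n (n + r), (E s (γ 0) - Eα s) / u ^ s
    have hD : D = (S (fun s => E s (γ 0)) (n + r) u - S Eα (n + r) u)
        - (S (fun s => E s (γ 0)) n u - S Eα n u) := by
      have e1 := S_sub_S (fun s => E s (γ 0)) hn r u
      have e2 := S_sub_S Eα hn r u
      simp only [D, sub_div, Finset.sum_sub_distrib]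
      rw [← e1, ← e2]; ring
    -- `Y_{n+r} = e^D Y_n`, whence `W/Y_n - 1 = (e^D - 1) + e^D (W/Y_{n+r} - 1)`.
    have e3 : W (γ 0) / lgApprox E Eα n u (γ 0) =
        Complex.exp D * (W (γ 0) / lgApprox E Eα (n + r) u (γ 0)) := by
      have h3 : lgApprox E Eα (n + r) u (γ 0) = Complex.exp D * lgApprox E Eα n u (γ 0) := by
        rw [lgApprox, lgApprox, ← mul_assoc, ← Complex.exp_add D, hD, sub_add_cancel]
      have h4 := Complex.exp_ne_zero D
      have h5 := lgApprox_ne_zero E Eα n u (γ 0)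
      rw [h3]; field_simp
    have e4 : Complex.exp (-(u * γ 0)) * (Complex.exp (u * γ 0) *
        (W (γ 0) / lgApprox E Eα n u (γ 0) - 1)) = (Complex.exp D - 1)
          + Complex.exp D * (W (γ 0) / lgApprox E Eα (n + r) u (γ 0) - 1) := by
      rw [← mul_assoc, ← Complex.exp_add, neg_add_cancel, Complex.exp_zero, e3]; ring
    rw [e4]
    refine (norm_add_le _ _).trans ?_
    gcongr
    rw [norm_mul, Complex.norm_exp, Real.exp_add (_ + _)]
    calc _ ≤ Real.exp D.re * (1 / ‖u‖ ^ (n + r) * arcInt (chi ψ (n + r) u) γ *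
          Real.exp (4 / ‖u‖ * arcInt (T ψ (n + r) u) γ
            + 1 / ‖u‖ ^ (n + r) * arcInt (chi ψ (n + r) u) γ)) := by gcongr
      _ = _ := by ring

end

end LiouvilleGreen

/-! ### Both ends at infinity. -/

theorem theorem1p2
    (Δ : Set ℂ) (hΔ : IsOpen Δ) (hΔc : IsSimplyConnected Δ)
    (ψ : ℂ → ℂ) (hψ : DifferentiableOn ℂ ψ Δ)
    (E : ℕ → ℂ → ℂ)
    (hE : ∀ s, 1 ≤ s → ∀ ξ ∈ Δ, HasDerivAt (E s) (LiouvilleGreen.F ψ s ξ) ξ)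
    (u : ℂ) (hu : u ≠ 0) :
    -- the solution attached to `α₁`, the point at infinity on `L`, with `Re (u α₁) = -∞`
    (∀ (L : ℝ → ℂ) (Eα : ℕ → ℂ), LiouvilleGreen.IsProgressive Δ u L →
      (∃ n, 1 ≤ n ∧ LiouvilleGreen.Converges ψ E n u L Eα) →
      ∃ (W : ℂ → ℂ) (ε : ℕ → ℂ → ℂ),
        LiouvilleGreen.IsSolution Δ ψ u W ∧
        -- `W` does not depend on `n`
        (∀ n, 1 ≤ n → ∀ ξ ∈ Δ,
          W ξ = Complex.exp (LiouvilleGreen.S (fun s => E s ξ) n u - LiouvilleGreen.S Eα n u)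
            * (Complex.exp (u * ξ) + ε n ξ)) ∧
        -- normalization and uniqueness
        Tendsto (fun t => W (L t) * Complex.exp (-(u * L t))) atTop (𝓝 1) ∧
        (∀ V, LiouvilleGreen.IsSolution Δ ψ u V →
          Tendsto (fun t => V (L t) * Complex.exp (-(u * L t))) atTop (𝓝 1) →
          EqOn V W Δ) ∧
        (∀ V, LiouvilleGreen.IsSolution Δ ψ u V → Tendsto (fun t => V (L t)) atTop (𝓝 0) →
          ∃ c : ℂ, ∀ ξ ∈ Δ, V ξ = c * W ξ) ∧
        -- error bounds
        (∀ (ξ : ℂ) (γ : ℝ → ℂ), γ 0 = ξ → LiouvilleGreen.IsProgressive Δ u γ →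
          (LiouvilleGreen.SameEnd γ L ∨
            Tendsto (fun t => W (γ t) * Complex.exp (-(u * γ t))) atTop (𝓝 1)) →
          ∀ n, 1 ≤ n →
            (LiouvilleGreen.Converges ψ E n u γ Eα →
              max ‖ε n ξ‖ ‖1 / u * deriv (ε n) ξ‖ ≤
                ‖Complex.exp (u * ξ) / u ^ n‖
                  * LiouvilleGreen.arcInt (LiouvilleGreen.chi ψ n u) γ
                  * Real.exp (4 / ‖u‖ * LiouvilleGreen.arcInt (LiouvilleGreen.T ψ n u) γ
                      + 1 / ‖u‖ ^ n * LiouvilleGreen.arcInt (LiouvilleGreen.chi ψ n u) γ)) ∧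
            (∀ r, 1 ≤ r → LiouvilleGreen.Converges ψ E (n + r) u γ Eα →
              ‖Complex.exp (-(u * ξ)) * ε n ξ‖ ≤
                ‖Complex.exp (∑ s ∈ Finset.Ico n (n + r), (E s ξ - Eα s) / u ^ s) - 1‖
                + 1 / ‖u‖ ^ (n + r)
                  * LiouvilleGreen.arcInt (LiouvilleGreen.chi ψ (n + r) u) γ
                  * Real.exp (4 / ‖u‖ * LiouvilleGreen.arcInt (LiouvilleGreen.T ψ (n + r) u) γ
                      + 1 / ‖u‖ ^ (n + r)
                        * LiouvilleGreen.arcInt (LiouvilleGreen.chi ψ (n + r) u) γ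
                      + (∑ s ∈ Finset.Ico n (n + r), (E s ξ - Eα s) / u ^ s).re)))) ∧
    -- the solution attached to `α₂`, the point at infinity on `L`, with `Re (u α₂) = +∞`
    (∀ (L : ℝ → ℂ) (Eα : ℕ → ℂ), LiouvilleGreen.IsProgressive Δ (-u) L →
      (∃ n, 1 ≤ n ∧ LiouvilleGreen.Converges ψ E n (-u) L Eα) →
      ∃ (W : ℂ → ℂ) (ε : ℕ → ℂ → ℂ),
        LiouvilleGreen.IsSolution Δ ψ u W ∧
        -- `W` does not depend on `n`
        (∀ n, 1 ≤ n → ∀ ξ ∈ Δ,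
          W ξ = Complex.exp
              (LiouvilleGreen.S (fun s => E s ξ) n (-u) - LiouvilleGreen.S Eα n (-u))
            * (Complex.exp (-(u * ξ)) + ε n ξ)) ∧
        -- normalization and uniqueness
        Tendsto (fun t => W (L t) * Complex.exp (u * L t)) atTop (𝓝 1) ∧
        (∀ V, LiouvilleGreen.IsSolution Δ ψ u V →
          Tendsto (fun t => V (L t) * Complex.exp (u * L t)) atTop (𝓝 1) →
          EqOn V W Δ) ∧
        (∀ V, LiouvilleGreen.IsSolution Δ ψ u V → Tendsto (fun t => V (L t)) atTop (𝓝 0) →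
          ∃ c : ℂ, ∀ ξ ∈ Δ, V ξ = c * W ξ) ∧
        -- error bounds
        (∀ (ξ : ℂ) (γ : ℝ → ℂ), γ 0 = ξ → LiouvilleGreen.IsProgressive Δ (-u) γ →
          (LiouvilleGreen.SameEnd γ L ∨
            Tendsto (fun t => W (γ t) * Complex.exp (u * γ t)) atTop (𝓝 1)) →
          ∀ n, 1 ≤ n →
            (LiouvilleGreen.Converges ψ E n (-u) γ Eα →
              max ‖ε n ξ‖ ‖1 / u * deriv (ε n) ξ‖ ≤
                ‖Complex.exp (-(u * ξ)) / u ^ n‖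
                  * LiouvilleGreen.arcInt (LiouvilleGreen.chi ψ n (-u)) γ
                  * Real.exp (4 / ‖u‖ * LiouvilleGreen.arcInt (LiouvilleGreen.T ψ n (-u)) γ
                      + 1 / ‖u‖ ^ n * LiouvilleGreen.arcInt (LiouvilleGreen.chi ψ n (-u)) γ)) ∧
            (∀ r, 1 ≤ r → LiouvilleGreen.Converges ψ E (n + r) (-u) γ Eα →
              ‖Complex.exp (u * ξ) * ε n ξ‖ ≤
                ‖Complex.exp
                    (∑ s ∈ Finset.Ico n (n + r), (-1) ^ s * ((E s ξ - Eα s) / u ^ s)) - 1‖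
                + 1 / ‖u‖ ^ (n + r)
                  * LiouvilleGreen.arcInt (LiouvilleGreen.chi ψ (n + r) (-u)) γ
                  * Real.exp (4 / ‖u‖ * LiouvilleGreen.arcInt (LiouvilleGreen.T ψ (n + r) (-u)) γ
                      + 1 / ‖u‖ ^ (n + r)
                        * LiouvilleGreen.arcInt (LiouvilleGreen.chi ψ (n + r) (-u)) γ
                      + (∑ s ∈ Finset.Ico n (n + r),
                          (-1) ^ s * ((E s ξ - Eα s) / u ^ s)).re)))) := by
  refine ⟨fun L Eα hL hconv =>
    LiouvilleGreen.exists_normalized_solution hΔ hΔc hψ hE hu L Eα hL hconv,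
    fun L Eα hL hconv => ?_⟩
  obtain ⟨W, ε, hW, hWε, hWL, huniq, hrec, hbd⟩ :=
    LiouvilleGreen.exists_normalized_solution hΔ hΔc hψ hE (neg_ne_zero.2 hu) L Eα hL hconv
  -- Turns the sums in powers of `-u` into the alternating form of `D`; the sign disappears under
  -- norms.
  have hpow : ∀ (s : ℕ) (x : ℂ), x / (-u) ^ s = (-1) ^ s * (x / u ^ s) := fun s x => by
    rw [neg_pow, div_mul_eq_div_div, div_eq_mul_inv x, ← inv_pow, inv_neg_one]; ring
  simp only [LiouvilleGreen.isSolution_neg, neg_mul, neg_neg] at hW hWε hWL huniq hrec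
  simp only [neg_mul, neg_neg, norm_neg, hpow] at hbd
  refine ⟨W, ε, hW, hWε, hWL, huniq, hrec, fun ξ γ hγξ hγ hend n hn => ?_⟩
  obtain ⟨h1, h2⟩ := hbd ξ γ hγξ hγ hend n hn
  refine ⟨fun hc => ?_, h2⟩
  have h3 := h1 hc
  have e1 : ‖1 / -u * deriv (ε n) ξ‖ = ‖1 / u * deriv (ε n) ξ‖ := by
    simp only [norm_mul, norm_div, norm_neg]
  have e2 : ∀ x : ℂ, ‖(-1) ^ n * (x / u ^ n)‖ = ‖x / u ^ n‖ := fun x => by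
    rw [norm_mul, norm_pow, norm_neg, norm_one, one_pow, one_mul]
  rwa [e1, e2] at h3
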